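/- Let $p,q\ge 2$, let $\Omega\subset\mathbb{R}^{p+q}=\mathbb{R}^p\times\mathbb{R}^q$ be a domain (non-empty, open, connected), and write its points as $(x,y)$. Let $E\subset\Omega$ be closed in $\Omega$ with $\mathcal{H}^{p+q-1}(E)<+\infty$, where $\mathcal{H}^{\alpha}$ is $\alpha$-dimensional Hausdorff measure. A function $u:U\to[-\infty,+\infty)$ on an open set $U$ is called subharmonic if it is upper semicontinuous and at the centre of every closed ball contained in $U$ is at most its (Lebesgue) mean value over that ball ($u\equiv-\infty$ is allowed). A function $v$ on an open set $U\subset\mathbb{R}^{p+q}$ is called separately subharmonic if $x\mapsto v(x,y)$ is subharmonic on $\{x:(x,y)\in U\}$ for every $y\in\mathbb{R}^q$, and $y\mapsto v(x,y)$ is subharmonic on $\{y:(x,y)\in U\}$ for every $x\in\mathbb{R}^p$. Let $w:\Omega\setminus E\to\mathbb{R}$ be separately subharmonic and such that: (i) $w\in L^1_{\mathrm{loc}}(\Omega)$ (note that $E$ is a Lebesgue null set); (ii) $w\in C^2(\Omega\setminus E)$; (iii) $\partial^2 w/\partial x_j^2\in L^1_{\mathrm{loc}}(\Omega)$ for $1\le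 j\le p$, and $\partial^2 w/\partial y_k^2\in L^1_{\mathrm{loc}}(\Omega)$ for $1\le k\le q$; (iv) for each $j$, $1\le j\le p$, write $X_j$ for the coordinates of $x$ other than $x_j$, and for $A\subset\mathbb{R}^{p+q}$ write $A(X_j,y)$ for the set of $x_j\in\mathbb{R}$ with $(x_j,X_j,y)\in A$. For $\mathcal{H}^{p+q-1}$-almost all $(X_j,y)\in\mathbb{R}^{p+q-1}$ such that $E(X_j,y)$ is finite, the following holds: for each $x_j^0\in E(X_j,y)$ there are sequences $s_l,t_l\in(\Omega\setminus E)(X_j,y)$ with $s_l\nearrow x_j^0$ and $t_l\searrow x_j^0$ as $l\to\infty$, such that $$\lim_{l\to\infty}w(s_l,X_j,y)=\lim_{l\to\infty}w(t_l,X_j,y)\in\mathbb{R},$$ $$-\infty<\liminf_{l\to\infty}\frac{\partial w}{\partial x_j}(s_l,X_j,y)\le\limsup_{l\to\infty}\frac{\partial w}{\partial x_j}(t_l,X_j,y)<+\infty;$$ (v) for each $k$, $1\le k\le q$, write $Y_k$ for the coordinates of $y$ other than $y_k$, and for $A\subset\mathbb{R}^{p+q}$ write $A(x,Y_k)$ for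 the set of $y_k\in\mathbb{R}$ with $(x,y_k,Y_k)\in A$. For $\mathcal{H}^{p+q-1}$-almost all $(x,Y_k)\in\mathbb{R}^{p+q-1}$ such that $E(x,Y_k)$ is finite, the following holds: for each $y_k^0\in E(x,Y_k)$ there are sequences $s_l,t_l\in(\Omega\setminus E)(x,Y_k)$ with $s_l\nearrow y_k^0$ and $t_l\searrow y_k^0$ as $l\to\infty$, such that $$\lim_{l\to\infty}w(x,s_l,Y_k)=\lim_{l\to\infty}w(x,t_l,Y_k)\in\mathbb{R},$$ $$-\infty<\liminf_{l\to\infty}\frac{\partial w}{\partial y_k}(x,s_l,Y_k)\le\limsup_{l\to\infty}\frac{\partial w}{\partial y_k}(x,t_l,Y_k)<+\infty.$$ Then $w$ has a separately subharmonic extension to $\Omega$: there is a separately subharmonic function $w^*:\Omega\to[-\infty,+\infty)$ with $w^*=w$ on $\Omega\setminus E$. -/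

import Mathlib

open MeasureTheory Filter Topology Set

noncomputable section

/-- The mean value of an extended real function `f` over the closed ball with centre `x` and radius
`r`, with respect to Lebesgue measure: the mean of the positive part minus the mean of the negative
part. For `f` bounded above on the ball this is the usual mean value, possibly `-∞`. -/
def ballMean {ι : Type*} [Fintype ι] (f : EuclideanSpace ℝ ι → EReal)
    (x : EuclideanSpace ℝ ι) (r : ℝ) : EReal :=
  ((⨍⁻ y in Metric.closedBall x r, (f y).toENNReal ∂volume : ENNReal) : EReal) -
    ((⨍⁻ y in Metric.closedBall x r, (-f y).toENNReal ∂volume : ENNReal) : EReal)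

/-- `f` is subharmonic on `U` (an open set): on `U` it takes values in `[-∞, +∞)`, is upper
semicontinuous, and lies below its mean value over every closed ball contained in `U`.
Functions that are identically `-∞` are allowed. -/
structure IsSubharmonicOn {ι : Type*} [Fintype ι] (f : EuclideanSpace ℝ ι → EReal)
    (U : Set (EuclideanSpace ℝ ι)) : Prop where
  lt_top : ∀ x ∈ U, f x < ⊤
  usc : UpperSemicontinuousOn f U
  le_ballMean : ∀ x, ∀ r : ℝ, 0 < r → Metric.closedBall x r ⊆ U → f x ≤ ballMean f x r

/-- The point `(x, y)` of `ℝ^{p+q}`, for `x` in `ℝ^p` and `y` in `ℝ^q`. -/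
def pairPt {p q : ℕ} (x : EuclideanSpace ℝ (Fin p)) (y : EuclideanSpace ℝ (Fin q)) :
    EuclideanSpace ℝ (Fin p ⊕ Fin q) :=
  WithLp.toLp 2 (Sum.elim (fun j => x j) (fun k => y k))

/-- `w` is separately subharmonic on `U`: for every fixed `y` the function `w(·, y)` is subharmonic
on the section `{x | (x, y) ∈ U}`, and for every fixed `x` the function `w(x, ·)` is subharmonic on
the section `{y | (x, y) ∈ U}`. -/
structure IsSeparatelySubharmonicOn {p q : ℕ} (w : EuclideanSpace ℝ (Fin p ⊕ Fin q) → EReal)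
    (U : Set (EuclideanSpace ℝ (Fin p ⊕ Fin q))) : Prop where
  left : ∀ y : EuclideanSpace ℝ (Fin q),
    IsSubharmonicOn (fun x : EuclideanSpace ℝ (Fin p) => w (pairPt x y)) {x | pairPt x y ∈ U}
  right : ∀ x : EuclideanSpace ℝ (Fin p),
    IsSubharmonicOn (fun y : EuclideanSpace ℝ (Fin q) => w (pairPt x y)) {y | pairPt x y ∈ U}

/-- The partial derivative of `u` with respect to the coordinate `i`. -/
def partialDeriv {ι : Type*} [Fintype ι] [DecidableEq ι] (i : ι) (u : EuclideanSpace ℝ ι → ℝ)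
    (x : EuclideanSpace ℝ ι) : ℝ :=
  lineDeriv ℝ u x (EuclideanSpace.single i 1)

/-- The point whose coordinate `i` is `t` and whose other coordinates are those of `X`. -/
def insertCoord {ι : Type*} [Fintype ι] [DecidableEq ι] (i : ι) (t : ℝ)
    (X : EuclideanSpace ℝ {k : ι // k ≠ i}) : EuclideanSpace ℝ ι :=
  WithLp.toLp 2 (fun k => if h : k = i then t else X ⟨k, h⟩)

/-- The section `{t | (t, X) ∈ A}` of `A` by the line parallel to the axis `i` through `X`. -/
def lineSection {ι : Type*} [Fintype ι] [DecidableEq ι] (i : ι)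
    (A : Set (EuclideanSpace ℝ ι)) (X : EuclideanSpace ℝ {k : ι // k ≠ i}) : Set ℝ :=
  {t | insertCoord i t X ∈ A}

/-- The one-sided conditions on the line parallel to the axis `i` through `X`: every point `t₀` of
`E` on the line is the limit of sequences `s l ↗ t₀` and `t l ↘ t₀` in `Ω \ E` along which `u` has
the same finite limit, and along which the lower limit of `∂u/∂xᵢ` from the left exceeds `-∞`, is
at most the upper limit of `∂u/∂xᵢ` from the right, and the latter is less than `+∞`. -/
def LineCondition {ι : Type*} [Fintype ι] [DecidableEq ι] (i : ι)
    (Ω E : Set (EuclideanSpace ℝ ι)) (u : EuclideanSpace ℝ ι → ℝ)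
    (X : EuclideanSpace ℝ {k : ι // k ≠ i}) : Prop :=
  ∀ t₀ ∈ lineSection i E X, ∃ s t : ℕ → ℝ,
    (∀ l, s l ∈ lineSection i (Ω \ E) X) ∧ (∀ l, t l ∈ lineSection i (Ω \ E) X) ∧
    Monotone s ∧ Tendsto s atTop (𝓝 t₀) ∧ Antitone t ∧ Tendsto t atTop (𝓝 t₀) ∧
    (∃ c : ℝ, Tendsto (fun l => u (insertCoord i (s l) X)) atTop (𝓝 c) ∧
      Tendsto (fun l => u (insertCoord i (t l) X)) atTop (𝓝 c)) ∧
    ⊥ < liminf (fun l => (partialDeriv i u (insertCoord i (s l) X) : EReal)) atTop ∧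
    liminf (fun l => (partialDeriv i u (insertCoord i (s l) X) : EReal)) atTop ≤
      limsup (fun l => (partialDeriv i u (insertCoord i (t l) X) : EReal)) atTop ∧
    limsup (fun l => (partialDeriv i u (insertCoord i (t l) X) : EReal)) atTop < ⊤

end

/-! The set `E` is crossed one coordinate direction at a time. Since its Hausdorff measure of
codimension one is finite, almost every line parallel to an axis meets it in finitely many points
(`ae_finite_lineSection`). On almost every such line the second derivative is locally integrable, so
`w` and its first derivative have one-sided limits at each point of `E`. The sequences in the line
condition then identify these limits: `w` does not jump, and its derivative can only jump upwards.
Integrating by parts against a nonnegative test function, each jump contributes with a favourable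
sign, so by Fubini the distributional second derivative dominates the pointwise one
(`integral_partialDeriv_mul_le`).

Off `E` the function is C² and subharmonic in each group of variables, so its two pointwise partial
Laplacians are nonnegative (`IsSubharmonicOn.partialLaplacian_nonneg`). Hence the Laplacian in `x`,
the Laplacian in `y`, and their sum are nonnegative as distributions on all of `Ω`.

The extension is the infimum of the radial averages of `w` over all admissible scales. Nonnegativity
of the full Laplacian makes these averages increase with the scale
(`IsWeaklySubharmonicOn.monotoneOn_radialAverage`), so the infimum is the limit at scale zero and
returns `w` wherever `w` is continuous. Nonnegativity of each partial Laplacian passes to the smooth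
averages, which therefore satisfy the mean value inequality on slices, and the inequality survives
the decreasing limit (`isSubharmonicOn_subharmonicRegularization_comp`). -/

/-! ### Integration by parts on a line across finitely many points -/

/-- A function whose derivative is integrable on an interval has a right limit at its left end. -/
theorem exists_tendsto_nhdsGT_of_integrableOn_deriv {g g' : ℝ → ℝ} {a b : ℝ} (hab : a < b)
    (hg : ∀ t ∈ Ioo a b, HasDerivAt g (g' t) t) (hi : IntegrableOn g' (Ioo a b)) :
    ∃ L, Tendsto g (𝓝[>] a) (𝓝 L) := by
  obtain ⟨c, hac, hcb⟩ := exists_between hab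
  have hi' : IntegrableOn g' (uIcc a c) := by
    rw [uIcc_of_le hac.le, integrableOn_Icc_iff_integrableOn_Ioc]
    exact hi.mono_set fun t ht => ⟨ht.1, ht.2.trans_lt hcb⟩
  have hc := (intervalIntegral.continuousOn_primitive_interval_left hi') a left_mem_uIcc
  rw [uIcc_of_le hac.le] at hc
  have h1 : Tendsto (fun x => ∫ t in x..c, g' t) (𝓝[>] a) (𝓝 (∫ t in a..c, g' t)) := by
    refine hc.mono_left ?_
    rw [nhdsWithin_Icc_eq_nhdsGE hac]
    exact nhdsWithin_mono _ Ioi_subset_Ici_self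
  refine ⟨g c - ∫ t in a..c, g' t, (tendsto_const_nhds.sub h1).congr' ?_⟩
  filter_upwards [Ioo_mem_nhdsGT hac] with x hx
  have hsub : uIcc x c ⊆ Ioo a b := by
    rw [uIcc_of_le hx.2.le]
    exact fun t ht => ⟨hx.1.trans_le ht.1, ht.2.trans_lt hcb⟩
  rw [intervalIntegral.integral_eq_sub_of_hasDerivAt (fun t ht => hg t (hsub ht))
    (hi.mono_set hsub).intervalIntegrable]
  ring

/-- A function whose derivative is integrable on an interval has a left limit at its right end. -/
theorem exists_tendsto_nhdsLT_of_integrableOn_deriv {g g' : ℝ → ℝ} {a b : ℝ} (hab : a < b)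
    (hg : ∀ t ∈ Ioo a b, HasDerivAt g (g' t) t) (hi : IntegrableOn g' (Ioo a b)) :
    ∃ L, Tendsto g (𝓝[<] b) (𝓝 L) := by
  obtain ⟨c, hac, hcb⟩ := exists_between hab
  have hi' : IntegrableOn g' (uIcc c b) := by
    rw [uIcc_of_le hcb.le, integrableOn_Icc_iff_integrableOn_Ico]
    exact hi.mono_set fun t ht => ⟨hac.trans_le ht.1, ht.2⟩
  have hc := (intervalIntegral.continuousOn_primitive_interval hi') b right_mem_uIcc
  rw [uIcc_of_le hcb.le] at hc
  have h1 : Tendsto (fun x => ∫ t in c..x, g' t) (𝓝[<] b) (𝓝 (∫ t in c..b, g' t)) := by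
    refine hc.mono_left ?_
    rw [nhdsWithin_Icc_eq_nhdsLE hcb]
    exact nhdsWithin_mono _ Iio_subset_Iic_self
  refine ⟨g c + ∫ t in c..b, g' t, (tendsto_const_nhds.add h1).congr' ?_⟩
  filter_upwards [Ioo_mem_nhdsLT hcb] with x hx
  have hsub : uIcc c x ⊆ Ioo a b := by
    rw [uIcc_of_le hx.1.le]
    exact fun t ht => ⟨hac.trans_le ht.1, ht.2.trans_lt hx.2⟩
  rw [intervalIntegral.integral_eq_sub_of_hasDerivAt (fun t ht => hg t (hsub ht))
    (hi.mono_set hsub).intervalIntegrable]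
  ring

/-- The fundamental theorem of calculus for a function that is differentiable off a finite set, at
the points of which it jumps downwards. -/
theorem sub_le_integral_of_hasDerivAt_of_jump {H H' : ℝ → ℝ} (F : Finset ℝ) :
    ∀ {a b A B : ℝ}, a < b → Tendsto H (𝓝[>] a) (𝓝 A) → Tendsto H (𝓝[<] b) (𝓝 B) →
    (∀ t ∈ Ioo a b, t ∉ F → HasDerivAt H (H' t) t) →
    (∀ t ∈ Ioo a b, t ∈ F →
      ∃ L R, Tendsto H (𝓝[<] t) (𝓝 L) ∧ Tendsto H (𝓝[>] t) (𝓝 R) ∧ R ≤ L) →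
    IntegrableOn H' (Ioo a b) → B - A ≤ ∫ t in a..b, H' t := by
  have key : ∀ {a b : ℝ}, a < b → IntegrableOn H' (Ioo a b) → IntervalIntegrable H' volume a b :=
    fun hab h => (intervalIntegrable_iff_integrableOn_Ioo_of_le hab.le).2 h
  induction F using Finset.induction_on with
  | empty =>
    intro a b A B hab hA hB hd _ hi
    rw [intervalIntegral.integral_eq_sub_of_hasDerivAt_of_tendsto hab
      (fun t ht => hd t ht (Finset.notMem_empty t)) (key hab hi) hA hB]
  | insert c F hc ih =>
    intro a b A B hab hA hB hd hj hi
    -- The interval is cut at the new exceptional point. Each half needs only the smaller set `F`,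
    -- and the drop `R - L ≤ 0` at the cut preserves the inequality.
    by_cases hcab : c ∈ Ioo a b
    · obtain ⟨L, R, hL, hR, hRL⟩ := hj c hcab (Finset.mem_insert_self _ _)
      have s1 : Ioo a c ⊆ Ioo a b := Ioo_subset_Ioo_right hcab.2.le
      have s2 : Ioo c b ⊆ Ioo a b := Ioo_subset_Ioo_left hcab.1.le
      have h1 := ih hcab.1 hA hL
        (fun t ht hF => hd t (s1 ht) (by simp [hF, ht.2.ne]))
        (fun t ht hF => hj t (s1 ht) (Finset.mem_insert_of_mem hF)) (hi.mono_set s1)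
      have h2 := ih hcab.2 hR hB
        (fun t ht hF => hd t (s2 ht) (by simp [hF, ht.1.ne']))
        (fun t ht hF => hj t (s2 ht) (Finset.mem_insert_of_mem hF)) (hi.mono_set s2)
      rw [← intervalIntegral.integral_add_adjacent_intervals (key hcab.1 (hi.mono_set s1))
        (key hcab.2 (hi.mono_set s2))]
      linarith
    · refine ih hab hA hB (fun t ht hF => hd t ht ?_)
        (fun t ht hF => hj t ht (Finset.mem_insert_of_mem hF)) hi
      rw [Finset.mem_insert, not_or]
      exact ⟨fun h => hcab (h ▸ ht), hF⟩

/-- A function with integrable second derivative on an interval has one-sided limits, together with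
its first derivative, at the left end. -/
theorem exists_tendsto_nhdsGT_of_integrableOn_deriv_deriv {g g₁ g₂ : ℝ → ℝ} {a b : ℝ}
    (hab : a < b) (hg : ∀ t ∈ Ioo a b, HasDerivAt g (g₁ t) t)
    (hg₁ : ∀ t ∈ Ioo a b, HasDerivAt g₁ (g₂ t) t) (hi : IntegrableOn g₂ (Ioo a b)) :
    (∃ L, Tendsto g (𝓝[>] a) (𝓝 L)) ∧ ∃ L, Tendsto g₁ (𝓝[>] a) (𝓝 L) := by
  obtain ⟨L₁, hL₁⟩ := exists_tendsto_nhdsGT_of_integrableOn_deriv hab hg₁ hi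
  obtain ⟨R₁, hR₁⟩ := exists_tendsto_nhdsLT_of_integrableOn_deriv hab hg₁ hi
  have hcont : ContinuousOn g₁ (Ioo a b) :=
    fun t ht => (hg₁ t ht).continuousAt.continuousWithinAt
  -- Having limits at both ends, `g₁` extends continuously to the closed interval, so it is
  -- integrable and the first-order lemma applies again, to `g`.
  have hint : IntegrableOn g₁ (Ioo a b) := by
    have := ((continuousOn_Icc_extendFrom_Ioo hcont hL₁ hR₁).integrableOn_Icc
      (μ := volume)).mono_set Ioo_subset_Icc_self
    refine this.congr_fun (fun t ht => ?_) measurableSet_Ioo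
    exact extendFrom_eq (subset_closure ht) (hcont t ht)
  exact ⟨exists_tendsto_nhdsGT_of_integrableOn_deriv hab hg hint, L₁, hL₁⟩

/-- A function with integrable second derivative on an interval has one-sided limits, together with
its first derivative, at the right end. -/
theorem exists_tendsto_nhdsLT_of_integrableOn_deriv_deriv {g g₁ g₂ : ℝ → ℝ} {a b : ℝ}
    (hab : a < b) (hg : ∀ t ∈ Ioo a b, HasDerivAt g (g₁ t) t)
    (hg₁ : ∀ t ∈ Ioo a b, HasDerivAt g₁ (g₂ t) t) (hi : IntegrableOn g₂ (Ioo a b)) :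
    (∃ L, Tendsto g (𝓝[<] b) (𝓝 L)) ∧ ∃ L, Tendsto g₁ (𝓝[<] b) (𝓝 L) := by
  obtain ⟨L₁, hL₁⟩ := exists_tendsto_nhdsGT_of_integrableOn_deriv hab hg₁ hi
  obtain ⟨R₁, hR₁⟩ := exists_tendsto_nhdsLT_of_integrableOn_deriv hab hg₁ hi
  have hcont : ContinuousOn g₁ (Ioo a b) :=
    fun t ht => (hg₁ t ht).continuousAt.continuousWithinAt
  have hint : IntegrableOn g₁ (Ioo a b) := by
    have := ((continuousOn_Icc_extendFrom_Ioo hcont hL₁ hR₁).integrableOn_Icc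
      (μ := volume)).mono_set Ioo_subset_Icc_self
    refine this.congr_fun (fun t ht => ?_) measurableSet_Ioo
    exact extendFrom_eq (subset_closure ht) (hcont t ht)
  exact ⟨exists_tendsto_nhdsLT_of_integrableOn_deriv hab hg hint, R₁, hR₁⟩

/-- Integration by parts against a nonnegative test function on a line, for a function that is
twice differentiable off a finite set `F`, continuous across `F`, and whose derivative jumps
upwards at the points of `F`. -/
theorem integral_mul_le_integral_mul_of_jump {O : Set ℝ} (hO : IsOpen O) {F : Set ℝ}
    (hF : F.Finite) {g g₁ g₂ φ φ₁ φ₂ : ℝ → ℝ}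
    (hg : ∀ t ∈ O \ F, HasDerivAt g (g₁ t) t) (hg₁ : ∀ t ∈ O \ F, HasDerivAt g₁ (g₂ t) t)
    (hi : IntegrableOn g₂ O)
    (hjump : ∀ t₀ ∈ F ∩ O, ∃ s t : ℕ → ℝ, Tendsto s atTop (𝓝[<] t₀) ∧ Tendsto t atTop (𝓝[>] t₀) ∧
      (∃ c : ℝ, Tendsto (fun l => g (s l)) atTop (𝓝 c) ∧ Tendsto (fun l => g (t l)) atTop (𝓝 c)) ∧
      liminf (fun l => (g₁ (s l) : EReal)) atTop ≤ limsup (fun l => (g₁ (t l) : EReal)) atTop)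
    (hφ : ∀ t, HasDerivAt φ (φ₁ t) t) (hφ₁ : ∀ t, HasDerivAt φ₁ (φ₂ t) t)
    (hc : HasCompactSupport φ) (hsupp : tsupport φ ⊆ O) (h0 : ∀ t, 0 ≤ φ t)
    (hgφ : Integrable (fun t => g t * φ₂ t)) (hφg : Integrable (fun t => g₂ t * φ t)) :
    ∫ t, g₂ t * φ t ≤ ∫ t, g t * φ₂ t := by
  have ev0 : ∀ t, t ∉ tsupport φ → φ =ᶠ[𝓝 t] 0 := fun t ht => notMem_tsupport_iff_eventuallyEq.1 ht
  have ev1 : ∀ t, t ∉ tsupport φ → φ₁ =ᶠ[𝓝 t] 0 := fun t ht => by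
    filter_upwards [(ev0 t ht).eventuallyEq_nhds] with x hx
    exact (hφ x).unique ((hasDerivAt_const x (0 : ℝ)).congr_of_eventuallyEq hx)
  have ev2 : ∀ t, t ∉ tsupport φ → φ₂ t = 0 := fun t ht =>
    (hφ₁ t).unique ((hasDerivAt_const t (0 : ℝ)).congr_of_eventuallyEq (ev1 t ht))
  -- The boundary term of two integrations by parts: `H'` is its derivative off `F`, and at a point
  -- of `F` it jumps by `-φ` times the upward jump of `g₁`, hence downwards.
  set H : ℝ → ℝ := fun t => g t * φ₁ t - g₁ t * φ t with hH
  set H' : ℝ → ℝ := fun t => g t * φ₂ t - g₂ t * φ t with hH'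
  have evH : ∀ t, t ∉ tsupport φ → H =ᶠ[𝓝 t] 0 := fun t ht => by
    filter_upwards [ev0 t ht, ev1 t ht] with x h0 h1
    simp [hH, h0, h1]
  have evH' : ∀ t, t ∉ tsupport φ → H' t = 0 := fun t ht => by
    simp [hH', ev2 t ht, (ev0 t ht).eq_of_nhds]
  obtain ⟨M, hM, hMs⟩ : ∃ M : ℝ, 0 < M ∧ tsupport φ ⊆ Ioo (-M) M := by
    obtain ⟨M, hM, hs⟩ := hc.isBounded.subset_ball_lt 0 0
    exact ⟨M, hM, by simpa [Real.ball_eq_Ioo] using hs⟩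
  have hend : ∀ t, t ∉ Ioo (-M) M → Tendsto H (𝓝 t) (𝓝 0) := fun t ht =>
    tendsto_const_nhds.congr' (evH t fun h => ht (hMs h)).symm
  have main : 0 - 0 ≤ ∫ t in (-M)..M, H' t := by
    refine sub_le_integral_of_hasDerivAt_of_jump (H := H) hF.toFinset (by linarith)
      ((hend _ (by simp)).mono_left nhdsWithin_le_nhds)
      ((hend _ (by simp)).mono_left nhdsWithin_le_nhds) ?_ ?_ (hgφ.sub hφg).integrableOn
    · intro t _ htF
      rw [Finite.mem_toFinset] at htF
      by_cases ht : t ∈ tsupport φ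
      · have hd := ((hg t ⟨hsupp ht, htF⟩).mul (hφ₁ t)).sub ((hg₁ t ⟨hsupp ht, htF⟩).mul (hφ t))
        refine hd.congr_deriv ?_
        simp only [hH']; ring
      · rw [evH' t ht]
        exact (hasDerivAt_const t (0 : ℝ)).congr_of_eventuallyEq (evH t ht)
    · intro t₀ _ htF
      rw [Finite.mem_toFinset] at htF
      by_cases ht : t₀ ∈ tsupport φ
      swap
      · have := (evH t₀ ht)
        exact ⟨0, 0, tendsto_const_nhds.congr' (this.filter_mono nhdsWithin_le_nhds).symm,
          tendsto_const_nhds.congr' (this.filter_mono nhdsWithin_le_nhds).symm, le_rfl⟩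
      have hO₀ : O ∈ 𝓝 t₀ := hO.mem_nhds (hsupp ht)
      have hF₀ : (F \ {t₀})ᶜ ∈ 𝓝 t₀ :=
        (hF.subset sdiff_subset).isClosed.isOpen_compl.mem_nhds (by simp)
      -- Within distance `η` of `t₀` there is no other point of `F`, so both one-sided intervals lie
      -- in the region of differentiability.
      obtain ⟨η, hη, hball⟩ := Metric.mem_nhds_iff.1 (inter_mem hO₀ hF₀)
      rw [Real.ball_eq_Ioo] at hball
      have sR : Ioo t₀ (t₀ + η) ⊆ O \ F := fun x hx => by
        have := hball ⟨by linarith [hx.1], hx.2⟩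
        exact ⟨this.1, fun h => this.2 ⟨h, hx.1.ne'⟩⟩
      have sL : Ioo (t₀ - η) t₀ ⊆ O \ F := fun x hx => by
        have := hball ⟨hx.1, by linarith [hx.2]⟩
        exact ⟨this.1, fun h => this.2 ⟨h, hx.2.ne⟩⟩
      obtain ⟨⟨cR, hcR⟩, dR, hdR⟩ := exists_tendsto_nhdsGT_of_integrableOn_deriv_deriv
        (by linarith : t₀ < t₀ + η) (fun t h => hg t (sR h)) (fun t h => hg₁ t (sR h))
        (hi.mono_set (sR.trans sdiff_subset))
      obtain ⟨⟨cL, hcL⟩, dL, hdL⟩ := exists_tendsto_nhdsLT_of_integrableOn_deriv_deriv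
        (by linarith : t₀ - η < t₀) (fun t h => hg t (sL h)) (fun t h => hg₁ t (sL h))
        (hi.mono_set (sL.trans sdiff_subset))
      obtain ⟨s, t, hs, ht', ⟨c, hc1, hc2⟩, hle⟩ := hjump t₀ ⟨htF, hsupp ht⟩
      -- The full one-sided limits exist already, so their values can be read off along the given
      -- sequences.
      have e1 : cL = c := tendsto_nhds_unique (hcL.comp hs) hc1
      have e2 : cR = c := tendsto_nhds_unique (hcR.comp ht') hc2
      have e3 : dL ≤ dR := by
        have l1 : Tendsto (fun l => (g₁ (s l) : EReal)) atTop (𝓝 (dL : EReal)) :=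
          (continuous_coe_real_ereal.tendsto _).comp (hdL.comp hs)
        have l2 : Tendsto (fun l => (g₁ (t l) : EReal)) atTop (𝓝 (dR : EReal)) :=
          (continuous_coe_real_ereal.tendsto _).comp (hdR.comp ht')
        rw [l1.liminf_eq, l2.limsup_eq] at hle
        exact EReal.coe_le_coe_iff.1 hle
      have c0 : Tendsto φ (𝓝 t₀) (𝓝 (φ t₀)) := (hφ t₀).continuousAt
      have c1 : Tendsto φ₁ (𝓝 t₀) (𝓝 (φ₁ t₀)) := (hφ₁ t₀).continuousAt
      refine ⟨cL * φ₁ t₀ - dL * φ t₀, cR * φ₁ t₀ - dR * φ t₀,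
        (hcL.mul (c1.mono_left nhdsWithin_le_nhds)).sub
          (hdL.mul (c0.mono_left nhdsWithin_le_nhds)),
        (hcR.mul (c1.mono_left nhdsWithin_le_nhds)).sub
          (hdR.mul (c0.mono_left nhdsWithin_le_nhds)), ?_⟩
      rw [e1, e2]
      have := mul_le_mul_of_nonneg_right e3 (h0 t₀)
      linarith
  have hsupp' : ∫ t in (-M)..M, H' t = ∫ t, H' t := by
    apply intervalIntegral.integral_eq_integral_of_support_subset
    intro x hx
    have : x ∈ tsupport φ := by
      by_contra h
      exact hx (evH' x h)
    exact Ioo_subset_Ioc_self (hMs this)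
  rw [hsupp', integral_sub hgφ hφg] at main
  linarith

/-! ### Fubini along coordinate lines, and line sections of sets of finite Hausdorff measure -/

section Lines

variable {ι : Type*} [Fintype ι] [DecidableEq ι]

/-- Splitting off the coordinate `i`, as a measurable equivalence. -/
def splitCoord (i : ι) : EuclideanSpace ℝ ι ≃ᵐ EuclideanSpace ℝ {k : ι // k ≠ i} × ℝ :=
  letI : Unique {k : ι // ¬ (k ≠ i)} := ⟨⟨⟨i, by simp⟩⟩, fun k => Subtype.ext (by simpa using k.2)⟩
  ((MeasurableEquiv.toLp 2 (ι → ℝ)).symm.trans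
    (MeasurableEquiv.piEquivPiSubtypeProd (fun _ : ι => ℝ) (fun k => k ≠ i))).trans
    ((MeasurableEquiv.toLp 2 ({k : ι // k ≠ i} → ℝ)).prodCongr
      (MeasurableEquiv.funUnique {k : ι // ¬ (k ≠ i)} ℝ))

theorem splitCoord_insertCoord (i : ι) (t : ℝ) (X : EuclideanSpace ℝ {k : ι // k ≠ i}) :
    splitCoord i (insertCoord i t X) = (X, t) := by
  refine Prod.ext ?_ ?_
  · ext k
    change (if h : (k : ι) = i then t else X ⟨k, h⟩) = X k
    rw [dif_neg k.2]
  · change (if h : i = i then t else X ⟨i, h⟩) = t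
    simp

theorem splitCoord_symm_apply (i : ι) (Xt : EuclideanSpace ℝ {k : ι // k ≠ i} × ℝ) :
    (splitCoord i).symm Xt = insertCoord i Xt.2 Xt.1 := by
  rw [MeasurableEquiv.symm_apply_eq, splitCoord_insertCoord]

theorem measurePreserving_splitCoord (i : ι) :
    MeasurePreserving (splitCoord i : EuclideanSpace ℝ ι → _) volume volume := by
  let : Unique {k : ι // ¬ (k ≠ i)} := ⟨⟨⟨i, by simp⟩⟩, fun k => Subtype.ext (by simpa using k.2)⟩
  have h1 : MeasurePreserving (MeasurableEquiv.piEquivPiSubtypeProd (fun _ : ι => ℝ)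
      (fun k => k ≠ i)) volume (volume.prod volume) :=
    volume_preserving_piEquivPiSubtypeProd (fun _ : ι => ℝ) (fun k => k ≠ i)
  have h2 : MeasurePreserving (MeasurableEquiv.funUnique {k : ι // ¬ (k ≠ i)} ℝ) volume volume := by
    convert! volume_preserving_funUnique {k : ι // ¬ (k ≠ i)} ℝ
  exact ((PiLp.volume_preserving_toLp {k : ι // k ≠ i}).prod h2).comp
    (h1.comp (PiLp.volume_preserving_ofLp ι))

/-- Inserting the coordinate `i` preserves the volume. -/
theorem measurePreserving_insertCoord (i : ι) :
    MeasurePreserving (fun Xt : EuclideanSpace ℝ {k : ι // k ≠ i} × ℝ => insertCoord i Xt.2 Xt.1)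
      (volume.prod volume) volume := by
  have h := (measurePreserving_splitCoord i).symm
  have he : ((splitCoord i).symm : _ → _) =
      fun Xt : EuclideanSpace ℝ {k : ι // k ≠ i} × ℝ => insertCoord i Xt.2 Xt.1 :=
    funext fun Xt => splitCoord_symm_apply i Xt
  rw [he] at h
  exact h

theorem measurableEmbedding_insertCoord (i : ι) :
    MeasurableEmbedding
      (fun Xt : EuclideanSpace ℝ {k : ι // k ≠ i} × ℝ => insertCoord i Xt.2 Xt.1) := by
  have he : ((splitCoord i).symm : _ → _) =
      fun Xt : EuclideanSpace ℝ {k : ι // k ≠ i} × ℝ => insertCoord i Xt.2 Xt.1 :=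
    funext fun Xt => splitCoord_symm_apply i Xt
  rw [← he]
  exact (splitCoord i).symm.measurableEmbedding

theorem integrable_comp_insertCoord {f : EuclideanSpace ℝ ι → ℝ} (hf : Integrable f) (i : ι) :
    Integrable (fun Xt : EuclideanSpace ℝ {k : ι // k ≠ i} × ℝ => f (insertCoord i Xt.2 Xt.1))
      (volume.prod volume) :=
  (measurePreserving_insertCoord i).integrable_comp_of_integrable hf

/-- An integrable function is integrable on almost every line parallel to an axis. -/
theorem ae_integrable_line {f : EuclideanSpace ℝ ι → ℝ} (hf : Integrable f) (i : ι) :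
    ∀ᵐ X : EuclideanSpace ℝ {k : ι // k ≠ i}, Integrable (fun t => f (insertCoord i t X)) :=
  (integrable_comp_insertCoord hf i).prod_right_ae

theorem integral_eq_integral_lines {f : EuclideanSpace ℝ ι → ℝ} (hf : Integrable f) (i : ι) :
    ∫ z, f z = ∫ X : EuclideanSpace ℝ {k : ι // k ≠ i}, ∫ t, f (insertCoord i t X) := by
  rw [← (measurePreserving_insertCoord i).integral_comp (measurableEmbedding_insertCoord i) f,
    integral_prod _ (integrable_comp_insertCoord hf i)]

theorem integrable_integral_lines {f : EuclideanSpace ℝ ι → ℝ} (hf : Integrable f) (i : ι) :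
    Integrable (fun X : EuclideanSpace ℝ {k : ι // k ≠ i} => ∫ t, f (insertCoord i t X)) :=
  (integrable_comp_insertCoord hf i).integral_prod_left

theorem insertCoord_add (i : ι) (t s : ℝ) (X : EuclideanSpace ℝ {k : ι // k ≠ i}) :
    insertCoord i (t + s) X = insertCoord i t X + s • EuclideanSpace.single i 1 := by
  ext k
  by_cases h : k = i <;> simp [insertCoord, h]

theorem edist_insertCoord (i : ι) (s t : ℝ) (X : EuclideanSpace ℝ {k : ι // k ≠ i}) :
    edist (insertCoord i s X) (insertCoord i t X) = edist s t := by
  have h : insertCoord i s X = insertCoord i t X + (s - t) • EuclideanSpace.single i 1 := by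
    rw [← insertCoord_add]; simp
  rw [edist_dist, edist_dist, h, dist_eq_norm, add_sub_cancel_left, norm_smul,
    PiLp.norm_single, norm_one, mul_one, Real.dist_eq, Real.norm_eq_abs]

theorem continuous_insertCoord (i : ι) (X : EuclideanSpace ℝ {k : ι // k ≠ i}) :
    Continuous fun t => insertCoord i t X :=
  Isometry.continuous fun s t => edist_insertCoord i s t X

/-- Forgetting the coordinate `i`. -/
def eraseCoord (i : ι) (z : EuclideanSpace ℝ ι) : EuclideanSpace ℝ {k : ι // k ≠ i} :=
  WithLp.toLp 2 fun k => z k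

theorem eraseCoord_insertCoord (i : ι) (t : ℝ) (X : EuclideanSpace ℝ {k : ι // k ≠ i}) :
    eraseCoord i (insertCoord i t X) = X := by
  ext k
  simp [eraseCoord, insertCoord, k.2]

theorem dist_eraseCoord_le (i : ι) (z z' : EuclideanSpace ℝ ι) :
    dist (eraseCoord i z) (eraseCoord i z') ≤ dist z z' := by
  rw [EuclideanSpace.dist_eq, EuclideanSpace.dist_eq]
  refine Real.sqrt_le_sqrt ?_
  have := Finset.sum_subtype (F := inferInstance) (Finset.univ.filter (· ≠ i)) (p := fun k => k ≠ i) (by simp)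
    (fun k => dist (z k) (z' k) ^ 2)
  calc ∑ k : {k : ι // k ≠ i}, dist (z k) (z' k) ^ 2
      = ∑ k ∈ Finset.univ.filter (· ≠ i), dist (z k) (z' k) ^ 2 := this.symm
    _ ≤ ∑ k, dist (z k) (z' k) ^ 2 :=
        Finset.sum_le_sum_of_subset_of_nonneg (Finset.filter_subset _ _) fun _ _ _ => sq_nonneg _

/-- The projection is 1-Lipschitz, so the image lies in a ball whose radius is the diameter of `U`.
The supremum over nonemptiness matches the summand in the definition of Hausdorff measure. -/
theorem volume_eraseCoord_image_le (i : ι) {d : ℝ} (hd : d = Fintype.card {k : ι // k ≠ i})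
    (U : Set (EuclideanSpace ℝ ι)) (hU : Metric.ediam U ≠ ⊤) :
    volume (eraseCoord i '' U) ≤
      (⨆ _ : U.Nonempty, Metric.ediam U ^ d) *
        volume (Metric.ball (0 : EuclideanSpace ℝ {k : ι // k ≠ i}) 1) := by
  rcases U.eq_empty_or_nonempty with rfl | hne
  · simp
  obtain ⟨z, hz⟩ := hne
  have hsub : eraseCoord i '' U ⊆ Metric.closedBall (eraseCoord i z) (Metric.ediam U).toReal := by
    rintro _ ⟨z', hz', rfl⟩
    refine (dist_eraseCoord_le i z' z).trans ?_
    rw [dist_edist]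
    exact ENNReal.toReal_mono hU (Metric.edist_le_ediam_of_mem hz' hz)
  refine (measure_mono hsub).trans ?_
  rw [Measure.addHaar_closedBall _ _ ENNReal.toReal_nonneg, finrank_euclideanSpace, ciSup_pos ⟨z, hz⟩,
    hd, ENNReal.rpow_natCast, ENNReal.ofReal_pow ENNReal.toReal_nonneg, ENNReal.ofReal_toReal hU]

/-- A set of finite Hausdorff measure of codimension one meets almost every line parallel to an
axis in a finite set. -/
theorem ae_finite_lineSection (i : ι) {d : ℝ} (hd : d = Fintype.card {k : ι // k ≠ i})
    {E : Set (EuclideanSpace ℝ ι)} (hE : Measure.hausdorffMeasure d E < ⊤) :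
    ∀ᵐ X : EuclideanSpace ℝ {k : ι // k ≠ i}, (lineSection i E X).Finite := by
  -- Any finite bound strictly above the measure works: below it there are covers of arbitrarily
  -- fine mesh.
  set M := Measure.hausdorffMeasure d E + 1 with hM
  have hMtop : M < ⊤ := ENNReal.add_lt_top.2 ⟨hE, ENNReal.one_lt_top⟩
  have hcov : ∀ m : ℕ, ∃ U : ℕ → Set (EuclideanSpace ℝ ι), E ⊆ ⋃ n, U n ∧
      (∀ n, Metric.ediam (U n) ≤ ((m : ENNReal) + 1)⁻¹) ∧
      ∑' n, ⨆ _ : (U n).Nonempty, Metric.ediam (U n) ^ d < M := by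
    intro m
    have h1 : Measure.hausdorffMeasure d E < M := ENNReal.lt_add_right hE.ne one_ne_zero
    rw [Measure.hausdorffMeasure_apply] at h1
    have h2 := (le_iSup₂ (f := fun (r : ENNReal) (_ : 0 < r) =>
      ⨅ (t : ℕ → Set (EuclideanSpace ℝ ι)) (_ : E ⊆ ⋃ n, t n)
        (_ : ∀ n, Metric.ediam (t n) ≤ r), ∑' n, ⨆ _ : (t n).Nonempty, Metric.ediam (t n) ^ d)
      ((m : ENNReal) + 1)⁻¹ (by simp)).trans_lt h1
    simp only [iInf_lt_iff] at h2
    obtain ⟨U, h3, h4, h5⟩ := h2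
    exact ⟨U, h3, h4, h5⟩
  choose U hEU hdiam hsum using hcov
  have hdiam' : ∀ m n, Metric.ediam (U m n) ≠ ⊤ := fun m n =>
    ((hdiam m n).trans_lt (by simp)).ne
  set C := volume (Metric.ball (0 : EuclideanSpace ℝ {k : ι // k ≠ i}) 1) with hC
  have hCtop : C < ⊤ := measure_ball_lt_top
  set B : ℕ → ℕ → Set (EuclideanSpace ℝ {k : ι // k ≠ i}) := fun m n =>
    toMeasurable volume (eraseCoord i '' U m n) with hB
  -- `g m X` counts the members of the `m`-th cover whose projection, enlarged to a measurable set
  -- of the same volume, contains `X`. Its integral is bounded uniformly in `m`, so by Fatou its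
  -- lower limit is finite almost everywhere.
  set g : ℕ → EuclideanSpace ℝ {k : ι // k ≠ i} → ENNReal := fun m X =>
    ∑' n, (B m n).indicator 1 X with hg
  have hgm : ∀ m, Measurable (g m) := fun m => by
    refine Measurable.tsum fun n => ?_
    exact measurable_one.indicator (measurableSet_toMeasurable _ _)
  have hgint : ∀ m, ∫⁻ X, g m X ≤ M * C := by
    intro m
    rw [hg]
    simp only
    rw [lintegral_tsum fun n =>
      (measurable_one.indicator (measurableSet_toMeasurable _ _)).aemeasurable]
    calc ∑' n, ∫⁻ X, (B m n).indicator 1 X = ∑' n, volume (B m n) := by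
          congr 1; ext n
          exact lintegral_indicator_one (measurableSet_toMeasurable _ _)
      _ ≤ ∑' n, (⨆ _ : (U m n).Nonempty, Metric.ediam (U m n) ^ d) * C := by
          refine ENNReal.tsum_le_tsum fun n => ?_
          rw [hB]
          simp only [measure_toMeasurable]
          exact volume_eraseCoord_image_le i hd _ (hdiam' m n)
      _ ≤ M * C := by
          rw [ENNReal.tsum_mul_right]
          gcongr
          exact (hsum m).le
  have hlim : ∫⁻ X, liminf (fun m => g m X) atTop ≠ ⊤ := by
    refine ((lintegral_liminf_le hgm).trans ?_).trans_lt (ENNReal.mul_lt_top hMtop hCtop) |>.ne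
    exact (liminf_le_liminf (Eventually.of_forall hgint)).trans (by simp)
  filter_upwards [ae_lt_top (Measurable.liminf hgm) hlim] with X hX
  by_contra hinf
  obtain ⟨N, hN⟩ := ENNReal.exists_nat_gt hX.ne
  obtain ⟨S, hSsub, hScard⟩ := Set.Infinite.exists_subset_card_eq hinf N
  -- Once the mesh is finer than the gaps between `N` chosen points of the section, these lie in `N`
  -- different members of the cover, so `N ≤ g m X`.
  have hsep : ∀ᶠ m : ℕ in atTop, ∀ s ∈ S, ∀ t ∈ S, s ≠ t → ((m : ENNReal) + 1)⁻¹ < edist s t := by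
    rw [Filter.eventually_all_finset]
    intro s _
    rw [Filter.eventually_all_finset]
    intro t _
    by_cases hst : s = t
    · simp [hst]
    · have h0 : Tendsto (fun m : ℕ => ((m : ENNReal) + 1)⁻¹) atTop (𝓝 0) := by
        have := (tendsto_add_atTop_iff_nat 1).2 ENNReal.tendsto_inv_nat_nhds_zero
        refine this.congr fun m => by push_cast; rfl
      filter_upwards [h0.eventually (gt_mem_nhds (edist_pos.2 hst))] with m hm _ using hm
  obtain ⟨m, hm1, hm2⟩ := ((frequently_lt_of_liminf_lt (by isBoundedDefault) hN).and_eventually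
    hsep).exists
  have hmem : ∀ s ∈ S, ∃ n, insertCoord i s X ∈ U m n := fun s hs =>
    mem_iUnion.1 (hEU m (hSsub hs))
  choose! n hn using hmem
  have hinj : InjOn n S := by
    intro s hs t ht hst
    by_contra hne
    have h1 := hm2 s hs t ht hne
    rw [← edist_insertCoord i s t X] at h1
    have h2 := Metric.edist_le_ediam_of_mem (hn s hs) (hst ▸ hn t ht)
    exact absurd (h1.trans_le (h2.trans (hdiam m (n s)))) (lt_irrefl _)
  have hge : (N : ENNReal) ≤ g m X := by
    calc (N : ENNReal) = ∑ k ∈ S.image n, 1 := by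
          rw [Finset.sum_const, Finset.card_image_of_injOn hinj, hScard, nsmul_eq_mul, mul_one]
      _ = ∑ k ∈ S.image n, (B m k).indicator 1 X := by
          refine Finset.sum_congr rfl fun k hk => ?_
          obtain ⟨s, hs, rfl⟩ := Finset.mem_image.1 hk
          rw [indicator_of_mem]
          · rfl
          · refine subset_toMeasurable _ _ ⟨_, hn s hs, eraseCoord_insertCoord i s X⟩
      _ ≤ g m X := ENNReal.sum_le_tsum _
  exact absurd (hm1.trans_le hge) (lt_irrefl _)

end Lines

/-! ### Comparison of Hausdorff and Lebesgue measure -/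

/-- A set of finite Hausdorff measure of codimension one is a Lebesgue null set. -/
theorem volume_eq_zero_of_hausdorffMeasure_lt_top {ι : Type*} [Fintype ι] {d : ℝ}
    (hd : d < Fintype.card ι)
    {E : Set (EuclideanSpace ℝ ι)} (hE : Measure.hausdorffMeasure d E < ⊤) : volume E = 0 := by
  have h := (Measure.hausdorffMeasure_zero_or_top hd E).resolve_right hE.ne
  have : (Measure.hausdorffMeasure (Fintype.card ι : ℝ) :
      Measure (EuclideanSpace ℝ ι)).IsAddHaarMeasure := by
    simpa using isAddHaarMeasure_hausdorffMeasure (E := EuclideanSpace ℝ ι)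
  exact Measure.absolutelyContinuous_isAddHaarMeasure volume _ h

/-- In the top dimension both are Haar measures. This turns the almost-everywhere line conditions
into Lebesgue ones, as Fubini requires. -/
theorem volume_absolutelyContinuous_hausdorffMeasure {ι : Type*} [Fintype ι] {d : ℝ}
    (hd : d = Fintype.card ι) :
    (volume : Measure (EuclideanSpace ℝ ι)) ≪ Measure.hausdorffMeasure d := by
  subst hd
  have : (Measure.hausdorffMeasure (Fintype.card ι : ℝ) :
      Measure (EuclideanSpace ℝ ι)).IsAddHaarMeasure := by
    simpa using isAddHaarMeasure_hausdorffMeasure (E := EuclideanSpace ℝ ι)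
  exact Measure.absolutelyContinuous_isAddHaarMeasure volume _

/-! ### Calculus of partial derivatives -/

section PartialDerivatives

variable {ι : Type*} [Fintype ι] [DecidableEq ι]

theorem ContDiffOn.partialDeriv_of_isOpen {n m : WithTop ℕ∞} {f : EuclideanSpace ℝ ι → ℝ}
    {U : Set (EuclideanSpace ℝ ι)} (hf : ContDiffOn ℝ n f U) (hU : IsOpen U) (hmn : m + 1 ≤ n)
    (i : ι) : ContDiffOn ℝ m (partialDeriv i f) U := by
  have h := (hf.fderiv_of_isOpen hU hmn).clm_apply
    (contDiffOn_const (c := EuclideanSpace.single i (1 : ℝ)))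
  refine h.congr fun x hx => ?_
  have h1 : n ≠ 0 := by rintro rfl; simp at hmn
  exact ((hf.contDiffAt (hU.mem_nhds hx)).differentiableAt h1).lineDeriv_eq_fderiv

theorem ContDiff.partialDeriv {n m : WithTop ℕ∞} {f : EuclideanSpace ℝ ι → ℝ}
    (hf : ContDiff ℝ n f) (hmn : m + 1 ≤ n) (i : ι) : ContDiff ℝ m (partialDeriv i f) :=
  contDiffOn_univ.1 (hf.contDiffOn.partialDeriv_of_isOpen isOpen_univ hmn i)

theorem Filter.EventuallyEq.partialDeriv_eq {f g : EuclideanSpace ℝ ι → ℝ}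
    {x : EuclideanSpace ℝ ι} (h : f =ᶠ[𝓝 x] g) (i : ι) : partialDeriv i f x = partialDeriv i g x :=
  h.lineDeriv_eq

theorem partialDeriv_zero (i : ι) : partialDeriv i (0 : EuclideanSpace ℝ ι → ℝ) = 0 := by
  ext x
  simp [partialDeriv, lineDeriv]

theorem tsupport_partialDeriv_subset (i : ι) (f : EuclideanSpace ℝ ι → ℝ) :
    tsupport (partialDeriv i f) ⊆ tsupport f := by
  refine closure_minimal (fun x hx => ?_) (isClosed_tsupport f)
  by_contra h
  refine hx ?_
  rw [(notMem_tsupport_iff_eventuallyEq.1 h).partialDeriv_eq i, partialDeriv_zero]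
  rfl

theorem hasDerivAt_comp_insertCoord {f : EuclideanSpace ℝ ι → ℝ} {i : ι} {t : ℝ}
    {X : EuclideanSpace ℝ {k : ι // k ≠ i}} (hf : DifferentiableAt ℝ f (insertCoord i t X)) :
    HasDerivAt (fun s => f (insertCoord i s X)) (partialDeriv i f (insertCoord i t X)) t := by
  have h := (hf.lineDifferentiableAt (v := EuclideanSpace.single i (1 : ℝ))).hasLineDerivAt
  have h1 : HasDerivAt (fun s => f (insertCoord i t X + s • EuclideanSpace.single i (1 : ℝ)))
      (partialDeriv i f (insertCoord i t X)) (t - t) := by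
    rw [sub_self]; exact h
  have h2 := h1.comp_sub_const t t
  refine h2.congr_of_eventuallyEq (Eventually.of_forall fun s => ?_)
  simp only [← insertCoord_add, add_sub_cancel]

end PartialDerivatives

theorem integrable_mul_of_tsupport_subset {X : Type*} [TopologicalSpace X] [T2Space X]
    [MeasurableSpace X]
    [OpensMeasurableSpace X] [TopologicalSpace.PseudoMetrizableSpace X] {μ : Measure X} {f ψ : X → ℝ} {Ω : Set X}
    (hf : LocallyIntegrableOn f Ω μ) (hψ : Continuous ψ) (hc : HasCompactSupport ψ)
    (hs : tsupport ψ ⊆ Ω) : Integrable (fun x => f x * ψ x) μ := by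
  have h1 : IntegrableOn (fun x => f x * ψ x) (tsupport ψ) μ :=
    (hf.integrableOn_compact_subset hs hc).mul_continuousOn hψ.continuousOn hc
  refine (integrableOn_iff_integrable_of_support_subset fun x hx => ?_).1 h1
  exact subset_tsupport ψ (right_ne_zero_of_mul hx)

theorem tendsto_nhdsLT_of_monotone {s : ℕ → ℝ} {t : ℝ} (hs : Monotone s)
    (h : Tendsto s atTop (𝓝 t)) (hne : ∀ l, s l ≠ t) : Tendsto s atTop (𝓝[<] t) :=
  tendsto_nhdsWithin_iff.2 ⟨h, Eventually.of_forall fun l =>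
    lt_of_le_of_ne (hs.ge_of_tendsto h l) (hne l)⟩

theorem tendsto_nhdsGT_of_antitone {s : ℕ → ℝ} {t : ℝ} (hs : Antitone s)
    (h : Tendsto s atTop (𝓝 t)) (hne : ∀ l, s l ≠ t) : Tendsto s atTop (𝓝[>] t) :=
  tendsto_nhdsWithin_iff.2 ⟨h, Eventually.of_forall fun l =>
    lt_of_le_of_ne (hs.le_of_tendsto h l) (hne l).symm⟩

/-! ### Weak partial Laplacians and the passage across the exceptional set -/

section Distributions

variable {ι : Type*} [Fintype ι] [DecidableEq ι]

/-- For a function that is `C²` off `E`, under the line condition on almost every line parallel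
to the axis `i`, the pointwise second derivative along `i` is at most the distributional one. -/
theorem integral_partialDeriv_mul_le {i : ι} {Ω E : Set (EuclideanSpace ℝ ι)} (hU : IsOpen (Ω \ E))
    (hΩ : IsOpen Ω) {w φ : EuclideanSpace ℝ ι → ℝ} (hw : ContDiffOn ℝ 2 w (Ω \ E))
    (hwi : LocallyIntegrableOn w Ω)
    (hwi₂ : LocallyIntegrableOn (partialDeriv i (partialDeriv i w)) Ω)
    (hfin : ∀ᵐ X : EuclideanSpace ℝ {k : ι // k ≠ i}, (lineSection i E X).Finite)
    (hline : ∀ᵐ X : EuclideanSpace ℝ {k : ι // k ≠ i}, LineCondition i Ω E w X)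
    (hφ : ContDiff ℝ 2 φ) (hc : HasCompactSupport φ) (hs : tsupport φ ⊆ Ω) (h0 : ∀ z, 0 ≤ φ z) :
    ∫ z, partialDeriv i (partialDeriv i w) z * φ z ≤
      ∫ z, w z * partialDeriv i (partialDeriv i φ) z := by
  have hφ₁ : ContDiff ℝ 1 (partialDeriv i φ) := hφ.partialDeriv (by norm_num) i
  have hφ₂ : ContDiff ℝ 0 (partialDeriv i (partialDeriv i φ)) := hφ₁.partialDeriv (by norm_num) i
  have hsupp₂ := (tsupport_partialDeriv_subset i (partialDeriv i φ)).trans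
    (tsupport_partialDeriv_subset i φ)
  have hint₁ := integrable_mul_of_tsupport_subset hwi₂ hφ.continuous hc hs
  have hint₂ := integrable_mul_of_tsupport_subset hwi hφ₂.continuous
    (hc.of_isClosed_subset (isClosed_tsupport _) hsupp₂) (hsupp₂.trans hs)
  have hw₁ : ContDiffOn ℝ 1 (partialDeriv i w) (Ω \ E) :=
    hw.partialDeriv_of_isOpen hU (by norm_num) i
  rw [integral_eq_integral_lines hint₁ i, integral_eq_integral_lines hint₂ i]
  refine integral_mono_ae (integrable_integral_lines hint₁ i) (integrable_integral_lines hint₂ i) ?_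
  -- The second derivative is integrable only on compact subsets of `Ω`. The line argument therefore
  -- runs in `interior K`, which still contains the support of `φ`.
  obtain ⟨K, hK, hKi, hKΩ⟩ := exists_compact_between hc hΩ hs
  have hintK : Integrable ((interior K).indicator (partialDeriv i (partialDeriv i w))) :=
    ((hwi₂.integrableOn_compact_subset hKΩ hK).mono_set interior_subset).integrable_indicator
      isOpen_interior.measurableSet
  filter_upwards [hfin, hline, ae_integrable_line hint₁ i, ae_integrable_line hint₂ i,
    ae_integrable_line hintK i] with X hfX hlX h1 h2 h3
  have hcont := continuous_insertCoord i X
  have hO : IsOpen (lineSection i (interior K) X) := isOpen_interior.preimage hcont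
  have hOΩ : ∀ t ∈ lineSection i (interior K) X \ lineSection i E X,
      insertCoord i t X ∈ Ω \ E := fun t ht => ⟨hKΩ (interior_subset ht.1), ht.2⟩
  have hts : tsupport (fun t => φ (insertCoord i t X)) ⊆
      (fun t => insertCoord i t X) ⁻¹' tsupport φ :=
    closure_minimal (fun t ht => subset_tsupport φ ht) ((isClosed_tsupport φ).preimage hcont)
  have hiso : Isometry fun t => insertCoord i t X := fun s t => edist_insertCoord i s t X
  refine integral_mul_le_integral_mul_of_jump hO hfX
    (g₁ := fun t => partialDeriv i w (insertCoord i t X))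
    (φ₁ := fun t => partialDeriv i φ (insertCoord i t X))
    (fun t ht => hasDerivAt_comp_insertCoord
      ((hw.contDiffAt (hU.mem_nhds (hOΩ t ht))).differentiableAt (by norm_num)))
    (fun t ht => hasDerivAt_comp_insertCoord
      ((hw₁.contDiffAt (hU.mem_nhds (hOΩ t ht))).differentiableAt (by norm_num))) ?_ ?_
    (fun t => hasDerivAt_comp_insertCoord (hφ.differentiable (by norm_num) _))
    (fun t => hasDerivAt_comp_insertCoord (hφ₁.differentiable (by norm_num) _)) ?_
    (fun t ht => hKi (hts ht)) (fun t => h0 _) h2 h1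
  · refine (integrable_indicator_iff hO.measurableSet).1 (h3.congr (Eventually.of_forall fun t => ?_))
    by_cases ht : insertCoord i t X ∈ interior K
    · have ht' : t ∈ lineSection i (interior K) X := ht
      simp [ht, ht']
    · have ht' : t ∉ lineSection i (interior K) X := ht
      simp [ht, ht']
  · intro t₀ ht₀
    obtain ⟨s, t, hsm, htm, hs1, hs2, ht1, ht2, hlim, -, hle, -⟩ := hlX t₀ ht₀.1
    refine ⟨s, t, tendsto_nhdsLT_of_monotone hs1 hs2 fun l h => ?_, tendsto_nhdsGT_of_antitone ht1 ht2 fun l h => ?_,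
      hlim, hle⟩
    · exact (hsm l).2 (h ▸ ht₀.1)
    · exact (htm l).2 (h ▸ ht₀.1)
  · exact (hiso.isClosedEmbedding.isCompact_preimage hc).of_isClosed_subset
      (isClosed_tsupport _) hts

/-- The sum of the second derivatives along the axes in `s`. -/
noncomputable def partialLaplacian (s : Finset ι) (f : EuclideanSpace ℝ ι → ℝ) (z : EuclideanSpace ℝ ι) : ℝ :=
  ∑ i ∈ s, partialDeriv i (partialDeriv i f) z

/-- The sum of the distributional second derivatives of `f` along the axes in `s` is nonnegative
on `Ω`. -/
def IsWeaklySubharmonicOn (s : Finset ι) (f : EuclideanSpace ℝ ι → ℝ)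
    (Ω : Set (EuclideanSpace ℝ ι)) : Prop :=
  ∀ φ : EuclideanSpace ℝ ι → ℝ, ContDiff ℝ 2 φ → HasCompactSupport φ → tsupport φ ⊆ Ω →
    (∀ z, 0 ≤ φ z) → 0 ≤ ∫ z, f z * partialLaplacian s φ z

theorem integrable_mul_partialDeriv_partialDeriv {Ω : Set (EuclideanSpace ℝ ι)}
    {w φ : EuclideanSpace ℝ ι → ℝ} (hwi : LocallyIntegrableOn w Ω)
    (hφ : ContDiff ℝ 2 φ) (hc : HasCompactSupport φ) (hs : tsupport φ ⊆ Ω) (i : ι) :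
    Integrable fun z => w z * partialDeriv i (partialDeriv i φ) z := by
  have hsupp₂ := (tsupport_partialDeriv_subset i (partialDeriv i φ)).trans
    (tsupport_partialDeriv_subset i φ)
  have hφ₂ : ContDiff ℝ 0 (partialDeriv i (partialDeriv i φ)) :=
    (hφ.partialDeriv (m := 1) (by norm_num) i).partialDeriv (by norm_num) i
  exact integrable_mul_of_tsupport_subset hwi hφ₂.continuous
    (hc.of_isClosed_subset (isClosed_tsupport _) hsupp₂) (hsupp₂.trans hs)

theorem integral_mul_partialLaplacian {Ω : Set (EuclideanSpace ℝ ι)}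
    {w φ : EuclideanSpace ℝ ι → ℝ} (hwi : LocallyIntegrableOn w Ω)
    (hφ : ContDiff ℝ 2 φ) (hc : HasCompactSupport φ) (hs : tsupport φ ⊆ Ω) (s : Finset ι) :
    ∫ z, w z * partialLaplacian s φ z = ∑ i ∈ s, ∫ z, w z * partialDeriv i (partialDeriv i φ) z := by
  simp only [partialLaplacian, Finset.mul_sum]
  exact integral_finsetSum _ fun i _ => integrable_mul_partialDeriv_partialDeriv hwi hφ hc hs i

theorem IsWeaklySubharmonicOn.union {s t : Finset ι} {Ω : Set (EuclideanSpace ℝ ι)}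
    {w : EuclideanSpace ℝ ι → ℝ} (hwi : LocallyIntegrableOn w Ω)
    (hs : IsWeaklySubharmonicOn s w Ω) (ht : IsWeaklySubharmonicOn t w Ω) (hst : Disjoint s t) :
    IsWeaklySubharmonicOn (s ∪ t) w Ω := by
  intro φ hφ hc hsupp h0
  have h1 := hs φ hφ hc hsupp h0
  have h2 := ht φ hφ hc hsupp h0
  rw [integral_mul_partialLaplacian hwi hφ hc hsupp] at h1 h2 ⊢
  rw [Finset.sum_union hst]
  exact add_nonneg h1 h2

/-- A function whose partial Laplacian is nonnegative off `E` is weakly subharmonic if on almost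
every line parallel to one of the axes its derivative jumps upwards at the points of `E`. -/
theorem isWeaklySubharmonicOn_of_lineCondition {s : Finset ι} {Ω E : Set (EuclideanSpace ℝ ι)}
    (hU : IsOpen (Ω \ E)) (hΩ : IsOpen Ω) (hE : volume E = 0) {w : EuclideanSpace ℝ ι → ℝ}
    (hw : ContDiffOn ℝ 2 w (Ω \ E)) (hwi : LocallyIntegrableOn w Ω)
    (hwi₂ : ∀ i ∈ s, LocallyIntegrableOn (partialDeriv i (partialDeriv i w)) Ω)
    (hfin : ∀ i ∈ s, ∀ᵐ X : EuclideanSpace ℝ {k : ι // k ≠ i}, (lineSection i E X).Finite)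
    (hline : ∀ i ∈ s, ∀ᵐ X : EuclideanSpace ℝ {k : ι // k ≠ i}, LineCondition i Ω E w X)
    (hpos : ∀ z ∈ Ω \ E, 0 ≤ partialLaplacian s w z) : IsWeaklySubharmonicOn s w Ω := by
  intro φ hφ hc hs h0
  rw [integral_mul_partialLaplacian hwi hφ hc hs]
  have h1 : 0 ≤ ∑ i ∈ s, ∫ z, partialDeriv i (partialDeriv i w) z * φ z := by
    rw [← integral_finsetSum _ fun i hi =>
      integrable_mul_of_tsupport_subset (hwi₂ i hi) hφ.continuous hc hs]
    refine integral_nonneg_of_ae ?_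
    filter_upwards [measure_eq_zero_iff_ae_notMem.1 hE] with z hz
    rw [← Finset.sum_mul]
    by_cases hzs : z ∈ tsupport φ
    · exact mul_nonneg (hpos z ⟨hs hzs, hz⟩) (h0 z)
    · simp [image_eq_zero_of_notMem_tsupport hzs]
  exact h1.trans (Finset.sum_le_sum fun i hi => integral_partialDeriv_mul_le hU hΩ hw hwi
    (hwi₂ i hi) (hfin i hi) (hline i hi) hφ hc hs h0)

/-- With empty exceptional set the line conditions are vacuous. -/
theorem isWeaklySubharmonicOn_of_contDiffOn {s : Finset ι} {U : Set (EuclideanSpace ℝ ι)}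
    (hU : IsOpen U) {f : EuclideanSpace ℝ ι → ℝ} (hf : ContDiffOn ℝ 2 f U)
    (hpos : ∀ z ∈ U, 0 ≤ partialLaplacian s f z) : IsWeaklySubharmonicOn s f U := by
  refine isWeaklySubharmonicOn_of_lineCondition (E := ∅) (by simpa using hU) hU (by simp)
    (by simpa using hf) (hf.continuousOn.locallyIntegrableOn hU.measurableSet) (fun i _ => ?_)
    (fun i _ => by simp [lineSection]) (fun i _ => by simp [lineSection, LineCondition])
    (by simpa using hpos)
  have h1 : ContDiffOn ℝ 1 (partialDeriv i f) U := hf.partialDeriv_of_isOpen hU (by norm_num) i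
  have h2 : ContDiffOn ℝ 0 (partialDeriv i (partialDeriv i f)) U :=
    h1.partialDeriv_of_isOpen hU (by norm_num) i
  exact h2.continuousOn.locallyIntegrableOn hU.measurableSet

end Distributions

/-! ### Radial profiles, kernels and potentials -/

/-- A nonnegative `C²` function vanishing on `[1, ∞)`, to be used as the profile of a radial
kernel. -/
structure IsRadialProfile (k : ℝ → ℝ) : Prop where
  contDiff : ContDiff ℝ 2 k
  nonneg : ∀ t, 0 ≤ k t
  eq_zero : ∀ t, 1 ≤ t → k t = 0

/-- The primitive of `-k` vanishing on `[1, ∞)`. -/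
noncomputable def profilePrimitive (k : ℝ → ℝ) (t : ℝ) : ℝ := ∫ s in t..1, k s

section Profile

variable {k : ℝ → ℝ}

theorem IsRadialProfile.hasDerivAt_profilePrimitive (hk : IsRadialProfile k) (t : ℝ) :
    HasDerivAt (profilePrimitive k) (-k t) t :=
  intervalIntegral.integral_hasDerivAt_left (hk.contDiff.continuous.intervalIntegrable _ _)
    (hk.contDiff.continuous.stronglyMeasurableAtFilter _ _) hk.contDiff.continuous.continuousAt

theorem IsRadialProfile.contDiff_profilePrimitive (hk : IsRadialProfile k) :
    ContDiff ℝ 2 (profilePrimitive k) := by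
  have h : ContDiff ℝ (1 + 1) (profilePrimitive k) := by
    rw [contDiff_succ_iff_deriv]
    refine ⟨fun t => (hk.hasDerivAt_profilePrimitive t).differentiableAt, by simp, ?_⟩
    have : deriv (profilePrimitive k) = fun t => -k t :=
      funext fun t => (hk.hasDerivAt_profilePrimitive t).deriv
    rw [this]
    exact (hk.contDiff.of_le (by norm_num)).neg
  simpa [one_add_one_eq_two] using h

theorem IsRadialProfile.profilePrimitive_eq_zero (hk : IsRadialProfile k) {t : ℝ} (ht : 1 ≤ t) :
    profilePrimitive k t = 0 := by
  rw [profilePrimitive, intervalIntegral.integral_symm, neg_eq_zero]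
  refine intervalIntegral.integral_zero_ae (Eventually.of_forall fun s hs => hk.eq_zero s ?_)
  rw [uIoc_of_le ht] at hs
  exact hs.1.le

theorem IsRadialProfile.profilePrimitive_nonneg (hk : IsRadialProfile k) (t : ℝ) :
    0 ≤ profilePrimitive k t := by
  rcases le_total t 1 with ht | ht
  · exact intervalIntegral.integral_nonneg ht fun s _ => hk.nonneg s
  · exact (hk.profilePrimitive_eq_zero ht).ge

theorem IsRadialProfile.const_mul (hk : IsRadialProfile k) {c : ℝ} (hc : 0 ≤ c) :
    IsRadialProfile fun t => c * k t :=
  ⟨contDiff_const.mul hk.contDiff, fun t => mul_nonneg hc (hk.nonneg t),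
    fun t ht => by rw [hk.eq_zero t ht, mul_zero]⟩

/-- As `m` grows these profiles tend to the indicator of `t < 1`, which recovers unweighted ball
means; `m = 1` supplies the mollifier. -/
theorem isRadialProfile_smoothTransition {m : ℝ} (hm : 0 ≤ m) :
    IsRadialProfile fun t => Real.smoothTransition (m * (1 - t)) :=
  ⟨Real.smoothTransition.contDiff.comp (contDiff_const.mul (contDiff_const.sub contDiff_id)),
    fun _ => Real.smoothTransition.nonneg _,
    fun _ ht => Real.smoothTransition.zero_of_nonpos
      (mul_nonpos_of_nonneg_of_nonpos hm (sub_nonpos.2 ht))⟩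

end Profile

section Kernel

variable {ι : Type*} [Fintype ι]

/-- The kernel with radial profile `k` at scale `ε`. -/
noncomputable def radialKernel (k : ℝ → ℝ) (ε : ℝ) (v : EuclideanSpace ℝ ι) : ℝ :=
  (ε ^ Fintype.card ι)⁻¹ * k (‖v‖ ^ 2 / ε ^ 2)

/-- The nonnegative function, the Laplacian of which is `ε` times the derivative of the radial
kernel with respect to the scale `ε`. -/
noncomputable def radialPotential (k : ℝ → ℝ) (ε : ℝ) (v : EuclideanSpace ℝ ι) : ℝ :=
  (ε ^ Fintype.card ι)⁻¹ * (ε ^ 2 / 2) * profilePrimitive k (‖v‖ ^ 2 / ε ^ 2)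

/-- The derivative of the radial kernel with respect to the scale. -/
noncomputable def radialKernelDeriv (k : ℝ → ℝ) (ε : ℝ) (v : EuclideanSpace ℝ ι) : ℝ :=
  -(ε⁻¹ * (ε ^ Fintype.card ι)⁻¹ *
    (Fintype.card ι * k (‖v‖ ^ 2 / ε ^ 2) + 2 * (‖v‖ ^ 2 / ε ^ 2) * deriv k (‖v‖ ^ 2 / ε ^ 2)))

variable {k : ℝ → ℝ}

theorem one_le_sq_div_sq {ε : ℝ} (hε : 0 < ε) {v : EuclideanSpace ℝ ι} (hv : ε ≤ ‖v‖) :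
    1 ≤ ‖v‖ ^ 2 / ε ^ 2 := by
  rw [one_le_div (by positivity)]
  gcongr

theorem IsRadialProfile.radialKernel_nonneg (hk : IsRadialProfile k) {ε : ℝ} (hε : 0 < ε)
    (v : EuclideanSpace ℝ ι) : 0 ≤ radialKernel k ε v :=
  mul_nonneg (by positivity) (hk.nonneg _)

theorem IsRadialProfile.radialPotential_nonneg (hk : IsRadialProfile k) {ε : ℝ} (hε : 0 < ε)
    (v : EuclideanSpace ℝ ι) : 0 ≤ radialPotential k ε v :=
  mul_nonneg (by positivity) (hk.profilePrimitive_nonneg _)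

theorem IsRadialProfile.radialKernel_eq_zero (hk : IsRadialProfile k) {ε : ℝ} (hε : 0 < ε)
    {v : EuclideanSpace ℝ ι} (hv : ε ≤ ‖v‖) : radialKernel k ε v = 0 := by
  rw [radialKernel, hk.eq_zero _ (one_le_sq_div_sq hε hv), mul_zero]

theorem IsRadialProfile.radialPotential_eq_zero (hk : IsRadialProfile k) {ε : ℝ} (hε : 0 < ε)
    {v : EuclideanSpace ℝ ι} (hv : ε ≤ ‖v‖) : radialPotential k ε v = 0 := by
  rw [radialPotential, hk.profilePrimitive_eq_zero (one_le_sq_div_sq hε hv), mul_zero]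

theorem IsRadialProfile.deriv_eq_zero (hk : IsRadialProfile k) {t : ℝ} (ht : 1 ≤ t) :
    deriv k t = 0 := by
  have h1 := (hk.contDiff.differentiable (by norm_num) t).hasDerivAt
  have h2 : HasDerivWithinAt k 0 (Ici t) t :=
    (hasDerivWithinAt_const t _ (0 : ℝ)).congr (fun s hs => hk.eq_zero s (ht.trans hs))
      (hk.eq_zero t ht)
  -- At `t = 1` only the right half-line is known to carry zero values, and the one-sided derivative
  -- suffices.
  exact (uniqueDiffWithinAt_Ici t).eq_deriv _ h1.hasDerivWithinAt h2

theorem IsRadialProfile.radialKernelDeriv_eq_zero (hk : IsRadialProfile k) {ε : ℝ} (hε : 0 < ε)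
    {v : EuclideanSpace ℝ ι} (hv : ε ≤ ‖v‖) : radialKernelDeriv k ε v = 0 := by
  have h := one_le_sq_div_sq hε hv
  rw [radialKernelDeriv, hk.eq_zero _ h, hk.deriv_eq_zero h]
  simp

theorem IsRadialProfile.contDiff_radialKernel (hk : IsRadialProfile k) (ε : ℝ) :
    ContDiff ℝ 2 (radialKernel k ε : EuclideanSpace ℝ ι → ℝ) :=
  contDiff_const.mul (hk.contDiff.comp ((contDiff_norm_sq ℝ).div_const _))

theorem IsRadialProfile.contDiff_radialPotential (hk : IsRadialProfile k) (ε : ℝ) :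
    ContDiff ℝ 2 (radialPotential k ε : EuclideanSpace ℝ ι → ℝ) :=
  contDiff_const.mul (hk.contDiff_profilePrimitive.comp ((contDiff_norm_sq ℝ).div_const _))

theorem IsRadialProfile.hasDerivAt_radialKernel (hk : IsRadialProfile k) {ε : ℝ} (hε : 0 < ε)
    (v : EuclideanSpace ℝ ι) :
    HasDerivAt (fun ε => radialKernel k ε v) (radialKernelDeriv k ε v) ε := by
  have h1 : HasDerivAt (fun ε : ℝ => (ε ^ Fintype.card ι)⁻¹)
      (-(Fintype.card ι * ε⁻¹ * (ε ^ Fintype.card ι)⁻¹)) ε := by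
    refine ((hasDerivAt_pow (Fintype.card ι) ε).fun_inv (by positivity)).congr_deriv ?_
    rcases Nat.eq_zero_or_pos (Fintype.card ι) with h | h
    · simp [h]
    · obtain ⟨m, hm⟩ := Nat.exists_eq_succ_of_ne_zero h.ne'
      rw [hm]
      simp only [Nat.succ_eq_add_one, Nat.add_sub_cancel]
      field_simp
      ring
  have h2 : HasDerivAt (fun ε : ℝ => ‖v‖ ^ 2 / ε ^ 2) (-(2 * (‖v‖ ^ 2 / ε ^ 2) * ε⁻¹)) ε := by
    refine ((hasDerivAt_const ε (‖v‖ ^ 2)).fun_div (hasDerivAt_pow 2 ε) (by positivity)).congr_deriv ?_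
    simp only [Nat.cast_ofNat]
    field_simp
    ring
  have h3 := (hk.contDiff.differentiable (by norm_num) (‖v‖ ^ 2 / ε ^ 2)).hasDerivAt
  refine (h1.mul (h3.comp ε h2)).congr_deriv ?_
  simp only [radialKernelDeriv, Function.comp_apply]
  ring

theorem tsupport_comp_sub_subset {g : EuclideanSpace ℝ ι → ℝ} {ε : ℝ}
    (hg : ∀ v, ε ≤ ‖v‖ → g v = 0) (z : EuclideanSpace ℝ ι) :
    tsupport (fun ζ => g (ζ - z)) ⊆ Metric.closedBall z ε := by
  refine closure_minimal (fun ζ hζ => ?_) Metric.isClosed_closedBall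
  rw [Metric.mem_closedBall, dist_eq_norm]
  by_contra h
  exact hζ (hg _ (not_le.1 h).le)

theorem hasCompactSupport_comp_sub {g : EuclideanSpace ℝ ι → ℝ} {ε : ℝ}
    (hg : ∀ v, ε ≤ ‖v‖ → g v = 0) (z : EuclideanSpace ℝ ι) :
    HasCompactSupport (fun ζ => g (ζ - z)) :=
  (isCompact_closedBall z ε).of_isClosed_subset (isClosed_tsupport _)
    (tsupport_comp_sub_subset hg z)

theorem hasLineDerivAt_radial [DecidableEq ι] {h h' : ℝ → ℝ} (hh : ∀ t, HasDerivAt h (h' t) t)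
    (a : ℝ) (z : EuclideanSpace ℝ ι) (i : ι) (ζ : EuclideanSpace ℝ ι) :
    HasLineDerivAt ℝ (fun ζ => h (‖ζ - z‖ ^ 2 / a)) (h' (‖ζ - z‖ ^ 2 / a) * (2 * (ζ i - z i) / a)) ζ
      (EuclideanSpace.single i 1) := by
  have h1 : HasDerivAt (fun t : ℝ => ζ + t • EuclideanSpace.single i (1 : ℝ) - z)
      (EuclideanSpace.single i (1 : ℝ)) 0 := by
    simpa using (((hasDerivAt_id (0 : ℝ)).smul_const
      (EuclideanSpace.single i (1 : ℝ))).const_add ζ).sub_const z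
  have h2 := (h1.norm_sq).div_const a
  simp only [zero_smul, add_zero, EuclideanSpace.inner_single_right] at h2
  have h3 := HasDerivAt.comp_of_eq (0 : ℝ) (hh (‖ζ - z‖ ^ 2 / a)) h2 (by simp)
  refine HasDerivAt.congr_deriv h3 ?_
  simp

/-- The potential has gradient `-v ρ_ε(v)`, where `ρ_ε` is the kernel, `v = ζ - z` and `n` is the
dimension. Differentiating `ρ_ε(v) = ε⁻ⁿ ρ(v/ε)` in the scale gives `ε ∂_ε ρ_ε = -n ρ_ε - v·∇ρ_ε`,
which is the divergence of that gradient. -/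
theorem IsRadialProfile.partialLaplacian_radialPotential [DecidableEq ι] (hk : IsRadialProfile k)
    {ε : ℝ} (hε : 0 < ε) (z ζ : EuclideanSpace ℝ ι) :
    partialLaplacian Finset.univ (fun ζ => radialPotential k ε (ζ - z)) ζ =
      ε * radialKernelDeriv k ε (ζ - z) := by
  have h1 : ∀ i : ι, partialDeriv i (fun ζ => radialPotential k ε (ζ - z)) = fun ζ =>
      -((ζ i - z i) * ((ε ^ Fintype.card ι)⁻¹ * k (‖ζ - z‖ ^ 2 / ε ^ 2))) := fun i => funext fun ζ => by
    have := (hasLineDerivAt_radial hk.hasDerivAt_profilePrimitive (ε ^ 2) z i ζ).const_mul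
      ((ε ^ Fintype.card ι)⁻¹ * (ε ^ 2 / 2))
    refine HasLineDerivAt.lineDeriv (HasDerivAt.congr_deriv this ?_)
    field_simp
  have h2 : ∀ i : ι, partialDeriv i (fun ζ : EuclideanSpace ℝ ι =>
      -((ζ i - z i) * ((ε ^ Fintype.card ι)⁻¹ * k (‖ζ - z‖ ^ 2 / ε ^ 2)))) ζ =
      -((ε ^ Fintype.card ι)⁻¹ * (k (‖ζ - z‖ ^ 2 / ε ^ 2) +
        2 * ((ζ i - z i) ^ 2 / ε ^ 2) * deriv k (‖ζ - z‖ ^ 2 / ε ^ 2))) := fun i => by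
    have e1 := (hasLineDerivAt_radial (fun t => (hk.contDiff.differentiable (by norm_num) t).hasDerivAt)
      (ε ^ 2) z i ζ).const_mul ((ε ^ Fintype.card ι)⁻¹)
    have e2 : HasLineDerivAt ℝ (fun ζ : EuclideanSpace ℝ ι => ζ i - z i) 1 ζ
        (EuclideanSpace.single i 1) := by
      have : HasDerivAt (fun t : ℝ => (ζ i - z i) + t) 1 0 := (hasDerivAt_id (0 : ℝ)).const_add _
      refine HasDerivAt.congr_of_eventuallyEq this (Eventually.of_forall fun t => ?_)
      simp
      ring
    refine HasLineDerivAt.lineDeriv (HasDerivAt.congr_deriv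
      (HasDerivAt.fun_neg (HasDerivAt.fun_mul e2 e1)) ?_)
    simp only [zero_smul, add_zero]
    ring
  have h3 : ‖ζ - z‖ ^ 2 = ∑ i, (ζ i - z i) ^ 2 := by
    rw [EuclideanSpace.norm_sq_eq]
    simp
  simp only [partialLaplacian, h1, h2, radialKernelDeriv]
  rw [Finset.sum_neg_distrib, ← Finset.mul_sum, Finset.sum_add_distrib, ← Finset.sum_mul,
    ← Finset.mul_sum, ← Finset.sum_div, ← h3, Finset.sum_const, Finset.card_univ, nsmul_eq_mul]
  field_simp

theorem integral_radialKernel (k : ℝ → ℝ) {ε : ℝ} (hε : 0 < ε) (z : EuclideanSpace ℝ ι) :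
    ∫ ζ, radialKernel k ε (ζ - z) = ∫ v : EuclideanSpace ℝ ι, k (‖v‖ ^ 2) := by
  rw [integral_sub_right_eq_self (fun v => radialKernel k ε v) z]
  have h1 : (fun v : EuclideanSpace ℝ ι => radialKernel k ε v) = fun v =>
      (ε ^ Fintype.card ι)⁻¹ * (fun u : EuclideanSpace ℝ ι => k (‖u‖ ^ 2)) (ε⁻¹ • v) := by
    ext v
    simp only [radialKernel, norm_smul, norm_inv, Real.norm_eq_abs, mul_pow, inv_pow, sq_abs]
    rw [div_eq_inv_mul]
  rw [h1, integral_const_mul, Measure.integral_comp_inv_smul volume (fun u : EuclideanSpace ℝ ι => k (‖u‖ ^ 2)), finrank_euclideanSpace,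
    abs_of_pos (by positivity), smul_eq_mul, ← mul_assoc, inv_mul_cancel₀ (by positivity), one_mul]

end Kernel

/-! ### Radial averages: monotonicity, limits and the mean value inequality -/

section Average

variable {ι : Type*} [Fintype ι] {k : ℝ → ℝ}

/-- The weighted average of `f` around `z` with radial profile `k` at scale `ε`. -/
noncomputable def radialAverage (k : ℝ → ℝ) (f : EuclideanSpace ℝ ι → ℝ) (ε : ℝ)
    (z : EuclideanSpace ℝ ι) : ℝ :=
  ∫ ζ, f ζ * radialKernel k ε (ζ - z)

theorem IsRadialProfile.integrable_mul_radialKernel (hk : IsRadialProfile k)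
    {f : EuclideanSpace ℝ ι → ℝ} {Ω : Set (EuclideanSpace ℝ ι)} (hf : LocallyIntegrableOn f Ω)
    {ε : ℝ} (hε : 0 < ε) {z : EuclideanSpace ℝ ι} (hz : Metric.closedBall z ε ⊆ Ω) :
    Integrable fun ζ => f ζ * radialKernel k ε (ζ - z) :=
  integrable_mul_of_tsupport_subset hf
    ((hk.contDiff_radialKernel ε).continuous.comp (continuous_id.sub continuous_const))
    (hasCompactSupport_comp_sub (fun _ => hk.radialKernel_eq_zero hε) z)
    ((tsupport_comp_sub_subset (fun _ => hk.radialKernel_eq_zero hε) z).trans hz)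

/-- The kernel vanishes off the ball. This allows a function integrable only locally in `Ω` to be
replaced by a truncation integrable on the whole space. -/
theorem radialAverage_indicator (hk : IsRadialProfile k) (f : EuclideanSpace ℝ ι → ℝ)
    {A : Set (EuclideanSpace ℝ ι)} {ε : ℝ} (hε : 0 < ε) {z : EuclideanSpace ℝ ι}
    (hz : Metric.closedBall z ε ⊆ A) :
    radialAverage k (A.indicator f) ε z = radialAverage k f ε z := by
  refine integral_congr_ae (Eventually.of_forall fun ζ => ?_)
  by_cases h : ζ ∈ A
  · simp [h]
  · have : ε ≤ ‖ζ - z‖ := by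
      by_contra hlt
      exact h (hz (by rw [Metric.mem_closedBall, dist_eq_norm]; exact (not_le.1 hlt).le))
    simp [hk.radialKernel_eq_zero hε this]

/-- The derivative of the weighted average with respect to the scale. -/
theorem IsRadialProfile.hasDerivAt_radialAverage (hk : IsRadialProfile k)
    {f : EuclideanSpace ℝ ι → ℝ} (hf : Integrable f) {ε : ℝ} (hε : 0 < ε)
    (z : EuclideanSpace ℝ ι) :
    HasDerivAt (fun ε => radialAverage k f ε z) (∫ ζ, f ζ * radialKernelDeriv k ε (ζ - z)) ε := by
  -- Scales in `[ε/2, 2ε]` stay away from zero, so compactness bounds the scale derivative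
  -- uniformly; this dominates the differentiation under the integral.
  have hcont : ContinuousOn (fun p : ℝ × EuclideanSpace ℝ ι => radialKernelDeriv k p.1 p.2)
      (Icc (ε / 2) (2 * ε) ×ˢ Metric.closedBall 0 (2 * ε)) := by
    have h1 : ∀ p ∈ Icc (ε / 2) (2 * ε) ×ˢ Metric.closedBall (0 : EuclideanSpace ℝ ι) (2 * ε),
        p.1 ≠ 0 := fun p hp => by
      have := hp.1.1
      exact (by linarith : (0 : ℝ) < p.1).ne'
    have h2 : ContinuousOn (fun p : ℝ × EuclideanSpace ℝ ι => ‖p.2‖ ^ 2 / p.1 ^ 2)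
        (Icc (ε / 2) (2 * ε) ×ˢ Metric.closedBall 0 (2 * ε)) :=
      (by fun_prop : Continuous fun p : ℝ × EuclideanSpace ℝ ι => ‖p.2‖ ^ 2).continuousOn.div
        (by fun_prop) fun p hp => pow_ne_zero _ (h1 p hp)
    have h3 := hk.contDiff.continuous.comp_continuousOn h2
    have h4 := (hk.contDiff.continuous_deriv (by norm_num)).comp_continuousOn h2
    have h5 : ContinuousOn (fun p : ℝ × EuclideanSpace ℝ ι => p.1⁻¹ * (p.1 ^ Fintype.card ι)⁻¹)
        (Icc (ε / 2) (2 * ε) ×ˢ Metric.closedBall 0 (2 * ε)) :=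
      (continuousOn_fst.inv₀ h1).mul
        ((continuousOn_fst.pow _).inv₀ fun p hp => pow_ne_zero _ (h1 p hp))
    exact (h5.mul ((continuousOn_const.mul h3).add ((continuousOn_const.mul h2).mul h4))).neg
  obtain ⟨C, hC⟩ := (isCompact_Icc.prod (isCompact_closedBall 0 (2 * ε))).exists_bound_of_continuousOn
    hcont
  have hbound : ∀ x ∈ Ioo (ε / 2) (2 * ε), ∀ v : EuclideanSpace ℝ ι,
      ‖radialKernelDeriv k x v‖ ≤ max C 0 := by
    intro x hx v
    by_cases hv : x ≤ ‖v‖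
    · rw [hk.radialKernelDeriv_eq_zero (by linarith [hx.1]) hv]
      simp
    · refine (hC (x, v) ⟨Ioo_subset_Icc_self hx, ?_⟩).trans (le_max_left _ _)
      rw [mem_closedBall_zero_iff]
      linarith [hx.2]
  have hkc : ∀ x, Continuous fun ζ : EuclideanSpace ℝ ι => radialKernel k x (ζ - z) := fun x =>
    (hk.contDiff_radialKernel x).continuous.comp (continuous_id.sub continuous_const)
  have hdc : Continuous fun ζ : EuclideanSpace ℝ ι => radialKernelDeriv k ε (ζ - z) := by
    have h2 : Continuous fun ζ : EuclideanSpace ℝ ι => ‖ζ - z‖ ^ 2 / ε ^ 2 := by fun_prop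
    have h3 := hk.contDiff.continuous.comp h2
    have h4 := (hk.contDiff.continuous_deriv (by norm_num)).comp h2
    exact (continuous_const.mul ((continuous_const.mul h3).add
      ((continuous_const.mul h2).mul h4))).neg
  refine (hasDerivAt_integral_of_dominated_loc_of_deriv_le
    (F' := fun x ζ => f ζ * radialKernelDeriv k x (ζ - z))
    (s := Ioo (ε / 2) (2 * ε))
    (bound := fun ζ => ‖f ζ‖ * max C 0) (Ioo_mem_nhds (by linarith) (by linarith))
    (Eventually.of_forall fun x => hf.aestronglyMeasurable.mul (hkc x).aestronglyMeasurable)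
    (hk.integrable_mul_radialKernel (hf.locallyIntegrable.locallyIntegrableOn univ) hε
      (subset_univ _)) (hf.aestronglyMeasurable.mul hdc.aestronglyMeasurable)
    (Eventually.of_forall fun ζ x hx => ?_) (hf.norm.mul_const _)
    (Eventually.of_forall fun ζ x hx => ?_)).2
  · rw [norm_mul]
    exact mul_le_mul_of_nonneg_left (hbound x hx _) (norm_nonneg _)
  · exact (hk.hasDerivAt_radialKernel (by linarith [hx.1]) _).const_mul _

/-- The weighted averages of a weakly subharmonic function increase with the scale. -/
theorem IsWeaklySubharmonicOn.monotoneOn_radialAverage [DecidableEq ι] {f : EuclideanSpace ℝ ι → ℝ}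
    {Ω : Set (EuclideanSpace ℝ ι)} (h : IsWeaklySubharmonicOn Finset.univ f Ω)
    (hf : LocallyIntegrableOn f Ω) (hk : IsRadialProfile k) {z : EuclideanSpace ℝ ι} {R : ℝ}
    (hz : Metric.closedBall z R ⊆ Ω) : MonotoneOn (fun ε => radialAverage k f ε z) (Ioc 0 R) := by
  set A := Metric.closedBall z R with hA
  have hfA : Integrable (A.indicator f) :=
    (hf.integrableOn_compact_subset hz (isCompact_closedBall z R)).integrable_indicator
      Metric.isClosed_closedBall.measurableSet
  have hmono : MonotoneOn (fun ε => radialAverage k (A.indicator f) ε z) (Ioc 0 R) := by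
    refine monotoneOn_of_deriv_nonneg (convex_Ioc 0 R)
      (fun ε hε => (hk.hasDerivAt_radialAverage hfA hε.1 z).continuousAt.continuousWithinAt)
      (fun ε hε => ?_) fun ε hε => ?_
    · rw [interior_Ioc] at hε
      exact (hk.hasDerivAt_radialAverage hfA hε.1 z).differentiableAt.differentiableWithinAt
    rw [interior_Ioc] at hε
    rw [(hk.hasDerivAt_radialAverage hfA hε.1 z).deriv]
    have hsub : Metric.closedBall z ε ⊆ A := Metric.closedBall_subset_closedBall hε.2.le
    -- The potential is an admissible nonnegative test function, and its Laplacian makes the tested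
    -- integral equal to `ε` times the scale derivative of the average.
    have h1 := h (fun ζ => radialPotential k ε (ζ - z))
      ((hk.contDiff_radialPotential ε).comp (contDiff_id.sub contDiff_const))
      (hasCompactSupport_comp_sub (fun _ => hk.radialPotential_eq_zero hε.1) z)
      ((tsupport_comp_sub_subset (fun _ => hk.radialPotential_eq_zero hε.1) z).trans
        (hsub.trans hz)) fun ζ => hk.radialPotential_nonneg hε.1 _
    have h2 : ∫ ζ, f ζ * partialLaplacian Finset.univ (fun ζ => radialPotential k ε (ζ - z)) ζ =
        ε * ∫ ζ, A.indicator f ζ * radialKernelDeriv k ε (ζ - z) := by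
      rw [← integral_const_mul]
      refine integral_congr_ae (Eventually.of_forall fun ζ => ?_)
      simp only [hk.partialLaplacian_radialPotential hε.1]
      by_cases hζ : ζ ∈ A
      · simp only [indicator_of_mem hζ]; ring
      · have : ε ≤ ‖ζ - z‖ := by
          by_contra hlt
          exact hζ (hsub (by rw [Metric.mem_closedBall, dist_eq_norm]; exact (not_le.1 hlt).le))
        simp [hk.radialKernelDeriv_eq_zero hε.1 this]
    rw [h2] at h1
    exact nonneg_of_mul_nonneg_right h1 hε.1
  refine hmono.congr fun ε hε => ?_
  exact radialAverage_indicator hk f hε.1 (Metric.closedBall_subset_closedBall hε.2)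

/-- The weighted averages around a point of continuity converge as the scale tends to zero. -/
theorem IsRadialProfile.tendsto_radialAverage (hk : IsRadialProfile k)
    {f : EuclideanSpace ℝ ι → ℝ} {Ω : Set (EuclideanSpace ℝ ι)} (hΩ : IsOpen Ω)
    (hf : LocallyIntegrableOn f Ω) {z : EuclideanSpace ℝ ι} (hz : z ∈ Ω) (hfz : ContinuousAt f z) :
    Tendsto (fun ε => radialAverage k f ε z) (𝓝[>] 0)
      (𝓝 (f z * ∫ v : EuclideanSpace ℝ ι, k (‖v‖ ^ 2))) := by
  set c := ∫ v : EuclideanSpace ℝ ι, k (‖v‖ ^ 2) with hc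
  have hc0 : 0 ≤ c := integral_nonneg fun v => hk.nonneg _
  rw [Metric.tendsto_nhds]
  intro η hη
  obtain ⟨δ₁, hδ₁, h1⟩ := Metric.mem_nhds_iff.1 (hΩ.mem_nhds hz)
  -- The kernel has mass `c`, possibly zero; dividing by `c + 1` keeps the total error strictly
  -- below `η`.
  obtain ⟨δ₂, hδ₂, h2⟩ := Metric.continuousAt_iff.1 hfz (η / (c + 1)) (by positivity)
  filter_upwards [Ioo_mem_nhdsGT (lt_min hδ₁ hδ₂)] with ε hε
  have hε1 := hε.2.trans_le (min_le_left _ _)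
  have hε2 := hε.2.trans_le (min_le_right _ _)
  have hi := hk.integrable_mul_radialKernel hf hε.1 ((Metric.closedBall_subset_ball hε1).trans h1)
  have hi1 : Integrable fun ζ => radialKernel k ε (ζ - z) := by
    simpa using hk.integrable_mul_radialKernel (f := fun _ => (1 : ℝ))
      ((locallyIntegrable_const 1).locallyIntegrableOn univ) hε.1 (subset_univ _)
  rw [Real.dist_eq, radialAverage, hc, ← integral_radialKernel k hε.1 z, ← integral_const_mul,
    ← integral_sub hi (hi1.const_mul _)]
  have hle : |∫ ζ, (f ζ * radialKernel k ε (ζ - z) - f z * radialKernel k ε (ζ - z))| ≤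
      ∫ ζ, η / (c + 1) * radialKernel k ε (ζ - z) := by
    refine abs_integral_le_integral_abs.trans (integral_mono (hi.sub (hi1.const_mul _)).abs
      (hi1.const_mul _) fun ζ => ?_)
    simp only
    rw [← sub_mul, abs_mul, abs_of_nonneg (hk.radialKernel_nonneg hε.1 _)]
    by_cases hζ : ε ≤ ‖ζ - z‖
    · rw [hk.radialKernel_eq_zero hε.1 hζ]; simp
    · refine mul_le_mul_of_nonneg_right ?_ (hk.radialKernel_nonneg hε.1 _)
      have := h2 (x := ζ) (by rw [dist_eq_norm]; exact (not_le.1 hζ).trans hε2)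
      rw [Real.dist_eq] at this
      exact this.le
  refine hle.trans_lt ?_
  rw [integral_const_mul, integral_radialKernel k hε.1 z, ← hc, div_mul_eq_mul_div,
    div_lt_iff₀ (by positivity)]
  nlinarith

/-- The cutoffs vanish off the open ball and tend to one inside it; dominated convergence applies,
and the bounding sphere is null. -/
theorem tendsto_integral_mul_smoothTransition {f : EuclideanSpace ℝ ι → ℝ}
    {z : EuclideanSpace ℝ ι} {r : ℝ} (hr : 0 < r) (hf : IntegrableOn f (Metric.closedBall z r)) :
    Tendsto (fun m : ℕ => ∫ ζ, f ζ * Real.smoothTransition (m * (1 - ‖ζ - z‖ ^ 2 / r ^ 2))) atTop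
      (𝓝 (∫ ζ in Metric.closedBall z r, f ζ)) := by
  have hball : Metric.ball z r =ᵐ[volume] Metric.closedBall z r := by
    refine ae_eq_of_subset_of_measure_ge Metric.ball_subset_closedBall ?_
      measurableSet_ball.nullMeasurableSet measure_closedBall_lt_top.ne
    rw [Measure.addHaar_closedBall _ _ hr.le, Measure.addHaar_ball_of_pos _ _ hr]
  have hset : ∀ m : ℕ, ∫ ζ, f ζ * Real.smoothTransition (m * (1 - ‖ζ - z‖ ^ 2 / r ^ 2)) =
      ∫ ζ in Metric.ball z r, f ζ * Real.smoothTransition (m * (1 - ‖ζ - z‖ ^ 2 / r ^ 2)) := by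
    intro m
    refine (setIntegral_eq_integral_of_forall_compl_eq_zero fun ζ hζ => ?_).symm
    rw [Metric.mem_ball, dist_eq_norm, not_lt] at hζ
    rw [Real.smoothTransition.zero_of_nonpos, mul_zero]
    exact mul_nonpos_of_nonneg_of_nonpos (Nat.cast_nonneg m)
      (sub_nonpos.2 (one_le_sq_div_sq hr hζ))
  simp only [hset]
  rw [← setIntegral_congr_set hball]
  have hf' : IntegrableOn f (Metric.ball z r) := hf.mono_set Metric.ball_subset_closedBall
  refine tendsto_integral_of_dominated_convergence (fun ζ => ‖f ζ‖) (fun m => ?_) hf'.norm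
    (fun m => Eventually.of_forall fun ζ => ?_) ?_
  · refine hf'.aestronglyMeasurable.mul (Continuous.aestronglyMeasurable ?_)
    exact Real.smoothTransition.continuous.comp (by fun_prop)
  · rw [norm_mul, Real.norm_of_nonneg (Real.smoothTransition.nonneg _)]
    exact mul_le_of_le_one_right (norm_nonneg _) (Real.smoothTransition.le_one _)
  · filter_upwards [ae_restrict_mem measurableSet_ball] with ζ hζ
    rw [Metric.mem_ball, dist_eq_norm] at hζ
    have hpos : 0 < 1 - ‖ζ - z‖ ^ 2 / r ^ 2 := by
      rw [sub_pos, div_lt_one (by positivity)]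
      gcongr
    have hev : ∀ᶠ m : ℕ in atTop, 1 ≤ (m : ℝ) * (1 - ‖ζ - z‖ ^ 2 / r ^ 2) :=
      (tendsto_natCast_atTop_atTop.atTop_mul_const hpos).eventually_ge_atTop 1
    refine tendsto_const_nhds.congr' ?_
    filter_upwards [hev] with m hm
    rw [Real.smoothTransition.one_of_one_le hm, mul_one]

/-- The mean value inequality for a `C²` function with nonnegative Laplacian. -/
theorem mul_volume_closedBall_le_integral [DecidableEq ι] {f : EuclideanSpace ℝ ι → ℝ}
    {U : Set (EuclideanSpace ℝ ι)} (hU : IsOpen U) (hf : ContDiffOn ℝ 2 f U)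
    (hpos : ∀ z ∈ U, 0 ≤ partialLaplacian Finset.univ f z) {z : EuclideanSpace ℝ ι} {r : ℝ}
    (hr : 0 < r) (hz : Metric.closedBall z r ⊆ U) :
    f z * volume.real (Metric.closedBall z r) ≤ ∫ ζ in Metric.closedBall z r, f ζ := by
  have hloc : LocallyIntegrableOn f U := hf.continuousOn.locallyIntegrableOn hU.measurableSet
  have hzU : z ∈ U := hz (Metric.mem_closedBall_self hr.le)
  have hweak := isWeaklySubharmonicOn_of_contDiffOn hU hf hpos
  have hm : ∀ m : ℕ, ∫ ζ, f z * Real.smoothTransition (m * (1 - ‖ζ - z‖ ^ 2 / r ^ 2)) ≤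
      ∫ ζ, f ζ * Real.smoothTransition (m * (1 - ‖ζ - z‖ ^ 2 / r ^ 2)) := by
    intro m
    have hk := isRadialProfile_smoothTransition (Nat.cast_nonneg (α := ℝ) m)
    -- For each profile the limit of the averages at scale zero is at most the average at scale `r`.
    -- The common factor `r⁻ⁿ` cancels, and `m → ∞` then yields the ball mean.
    have h1 := hk.tendsto_radialAverage hU hloc hzU (hf.continuousOn.continuousAt (hU.mem_nhds hzU))
    have h2 := le_of_tendsto h1 (b := radialAverage _ f r z) (by
      filter_upwards [Ioc_mem_nhdsGT hr] with ε hε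
      exact hweak.monotoneOn_radialAverage hloc hk hz hε ⟨hr, le_rfl⟩ hε.2)
    rw [← integral_radialKernel (fun t => Real.smoothTransition (m * (1 - t))) hr z, ← integral_const_mul] at h2
    simp only [radialAverage, radialKernel, mul_left_comm _ (r ^ Fintype.card ι)⁻¹] at h2
    rw [integral_const_mul (r ^ Fintype.card ι)⁻¹, integral_const_mul (r ^ Fintype.card ι)⁻¹] at h2
    exact le_of_mul_le_mul_left h2 (by positivity)
  have l1 := tendsto_integral_mul_smoothTransition (f := fun _ => f z) hr
    (integrableOn_const (measure_closedBall_lt_top (x := z)).ne)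
  have l2 := tendsto_integral_mul_smoothTransition hr
    (hloc.integrableOn_compact_subset hz (isCompact_closedBall z r))
  have := le_of_tendsto_of_tendsto' l1 l2 hm
  rwa [setIntegral_const, smul_eq_mul, mul_comm] at this

end Average

/-! ### Extended real ball means and the Laplacian of a C² subharmonic function -/

section BallMean

variable {ι : Type*} [Fintype ι]

theorem EReal.toENNReal_coe_real (x : ℝ) : (x : EReal).toENNReal = ENNReal.ofReal x := by
  simp [EReal.toENNReal]

/-- The mean value of a real function over a ball as an extended real number. -/
theorem ballMean_coe {f : EuclideanSpace ℝ ι → ℝ} {x : EuclideanSpace ℝ ι} {r : ℝ}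
    (hf : IntegrableOn f (Metric.closedBall x r)) :
    ballMean (fun y => (f y : EReal)) x r =
      (((∫ y in Metric.closedBall x r, f y) / volume.real (Metric.closedBall x r) : ℝ) : EReal) := by
  by_cases hV : volume (Metric.closedBall x r) = 0
  · simp [ballMean, measureReal_def, hV, Measure.restrict_eq_zero.2 hV]
  have hVt : volume (Metric.closedBall x r) ≠ ⊤ := measure_closedBall_lt_top.ne
  have h1 : ∫⁻ y in Metric.closedBall x r, ENNReal.ofReal (f y) ≠ ⊤ := by
    refine (lt_of_le_of_lt (lintegral_mono fun y => ?_) hf.2).ne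
    exact Real.ofReal_le_enorm (f y)
  have h2 : ∫⁻ y in Metric.closedBall x r, ENNReal.ofReal (-f y) ≠ ⊤ := by
    refine (lt_of_le_of_lt (lintegral_mono fun y => ?_) hf.2).ne
    rw [← enorm_neg]
    exact Real.ofReal_le_enorm (-f y)
  simp only [ballMean, ← EReal.coe_neg, EReal.toENNReal_coe_real, setLAverage_eq]
  rw [integral_eq_lintegral_pos_part_sub_lintegral_neg_part hf,
    ← EReal.coe_ennreal_toReal (ENNReal.div_ne_top h1 hV),
    ← EReal.coe_ennreal_toReal (ENNReal.div_ne_top h2 hV), ← EReal.coe_sub, sub_div,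
    ENNReal.toReal_div, ENNReal.toReal_div, measureReal_def]

/-- A lower bound for the mean values of a decreasing sequence of continuous functions is a lower
bound for the mean value of its limit. -/
theorem le_ballMean_of_antitone {g : ℕ → EuclideanSpace ℝ ι → ℝ} {G : EuclideanSpace ℝ ι → EReal}
    {x : EuclideanSpace ℝ ι} {r : ℝ} (hr : 0 < r) (hg : ∀ m, Continuous (g m))
    (hanti : ∀ y ∈ Metric.closedBall x r, Antitone fun m => g m y)
    (hG : ∀ y ∈ Metric.closedBall x r, G y = ⨅ m, (g m y : EReal)) {a : EReal}
    (ha : ∀ m, a ≤ ballMean (fun y => (g m y : EReal)) x r) : a ≤ ballMean G x r := by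
  set μ := volume.restrict (Metric.closedBall x r) with hμ
  set ν := (μ univ)⁻¹ • μ with hν
  have hmem : ∀ᵐ y ∂ν, y ∈ Metric.closedBall x r := by
    refine Measure.ae_smul_measure ?_ _
    exact ae_restrict_mem Metric.isClosed_closedBall.measurableSet
  have hV0 : μ univ ≠ 0 := by
    rw [hμ, Measure.restrict_apply_univ]
    exact (Metric.measure_closedBall_pos volume x hr).ne'
  have hlim : ∀ᵐ y ∂ν, Tendsto (fun m => (g m y : EReal)) atTop (𝓝 (G y)) := by
    filter_upwards [hmem] with y hy
    rw [hG y hy]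
    exact tendsto_atTop_iInf fun m n hmn => EReal.coe_le_coe_iff.2 (hanti y hy hmn)
  have hmeas : ∀ m, Measurable fun y => ((g m y : ℝ) : EReal) := fun m =>
    measurable_coe_real_ereal.comp (hg m).measurable
  -- Positive parts decrease, so monotone convergence needs a finite start; negative parts increase
  -- and may have infinite integral in the limit.
  have hp0 : ∫⁻ y, ((g 0 y : ℝ) : EReal).toENNReal ∂ν ≠ ⊤ := by
    rw [hν, lintegral_smul_measure, smul_eq_mul]
    refine ENNReal.mul_ne_top (ENNReal.inv_ne_top.2 hV0) ?_
    simp only [EReal.toENNReal_coe_real]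
    exact (lt_of_le_of_lt (lintegral_mono fun y => Real.ofReal_le_enorm (g 0 y))
      ((hg 0).continuousOn.integrableOn_compact (isCompact_closedBall x r)).2).ne
  have h1 : Tendsto (fun m => ∫⁻ y, ((g m y : ℝ) : EReal).toENNReal ∂ν) atTop
      (𝓝 (∫⁻ y, (G y).toENNReal ∂ν)) := by
    refine lintegral_tendsto_of_tendsto_of_antitone
      (fun m => (hmeas m).ereal_toENNReal.aemeasurable) ?_ hp0 ?_
    · filter_upwards [hmem] with y hy m n hmn
      exact EReal.toENNReal_le_toENNReal (EReal.coe_le_coe_iff.2 (hanti y hy hmn))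
    · filter_upwards [hlim] with y hy
      exact (EReal.continuous_toENNReal.tendsto _).comp hy
  have h2 : Tendsto (fun m => ∫⁻ y, (-((g m y : ℝ) : EReal)).toENNReal ∂ν) atTop
      (𝓝 (∫⁻ y, (-G y).toENNReal ∂ν)) := by
    refine lintegral_tendsto_of_tendsto_of_monotone
      (fun m => (hmeas m).neg.ereal_toENNReal.aemeasurable) ?_ ?_
    · filter_upwards [hmem] with y hy m n hmn
      exact EReal.toENNReal_le_toENNReal
        (EReal.neg_le_neg_iff.2 (EReal.coe_le_coe_iff.2 (hanti y hy hmn)))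
    · filter_upwards [hlim] with y hy
      exact ((EReal.continuous_toENNReal.comp continuous_neg).tendsto _).comp hy
  -- Finiteness of the positive part excludes `∞ - ∞`, so subtraction is continuous at the limit.
  have hptop : ∫⁻ y, (G y).toENNReal ∂ν ≠ ⊤ := by
    refine (lt_of_le_of_lt (lintegral_mono_ae ?_) hp0.lt_top).ne
    filter_upwards [hmem] with y hy
    rw [hG y hy]
    exact EReal.toENNReal_le_toENNReal (iInf_le _ 0)
  have h3 : Tendsto (fun m => ballMean (fun y => (g m y : EReal)) x r) atTop
      (𝓝 (ballMean G x r)) := by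
    simp only [ballMean, laverage_eq', sub_eq_add_neg]
    have e1 := (continuous_coe_ennreal_ereal.tendsto _).comp h1
    have e2 := ((continuous_neg.comp continuous_coe_ennreal_ereal).tendsto _).comp h2
    exact (EReal.continuousAt_add
      (p := (((∫⁻ y, (G y).toENNReal ∂ν : ENNReal) : EReal),
        -((∫⁻ y, (-G y).toENNReal ∂ν : ENNReal) : EReal)))
      (Or.inl (by simpa using hptop)) (Or.inl (EReal.coe_ennreal_ne_bot _))).tendsto.comp
      (e1.prodMk_nhds e2)
  exact ge_of_tendsto' h3 ha

variable [DecidableEq ι]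

theorem partialLaplacian_neg_sub_norm_sq {f : EuclideanSpace ℝ ι → ℝ}
    {U : Set (EuclideanSpace ℝ ι)} (hU : IsOpen U) (hf : ContDiffOn ℝ 2 f U) (c : ℝ)
    (x : EuclideanSpace ℝ ι) {z : EuclideanSpace ℝ ι} (hz : z ∈ U) :
    partialLaplacian Finset.univ (fun ζ => -f ζ - c * ‖ζ - x‖ ^ 2) z =
      -partialLaplacian Finset.univ f z - 2 * c * Fintype.card ι := by
  have h1 : ∀ i, ∀ ζ ∈ U, partialDeriv i (fun ζ => -f ζ - c * ‖ζ - x‖ ^ 2) ζ =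
      -partialDeriv i f ζ - c * (2 * (ζ i - x i)) := fun i ζ hζ => by
    have e1 := (((hf.contDiffAt (hU.mem_nhds hζ)).differentiableAt
      (by norm_num)).lineDifferentiableAt (v := EuclideanSpace.single i (1 : ℝ))).hasLineDerivAt
    have e2 := hasLineDerivAt_radial hasDerivAt_id' 1 x i ζ
    simp only [div_one, one_mul] at e2
    exact HasLineDerivAt.lineDeriv (HasDerivAt.fun_sub (HasDerivAt.fun_neg e1)
      (HasDerivAt.const_mul c e2))
  have h2 : ∀ i, partialDeriv i (partialDeriv i fun ζ => -f ζ - c * ‖ζ - x‖ ^ 2) z =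
      -partialDeriv i (partialDeriv i f) z - 2 * c := fun i => by
    have ev : partialDeriv i (fun ζ => -f ζ - c * ‖ζ - x‖ ^ 2) =ᶠ[𝓝 z]
        fun ζ => -partialDeriv i f ζ - c * (2 * (ζ i - x i)) :=
      Filter.eventually_of_mem (hU.mem_nhds hz) (h1 i)
    rw [ev.partialDeriv_eq i]
    have e1 := ((((hf.partialDeriv_of_isOpen (m := 1) hU (by norm_num) i).contDiffAt
      (hU.mem_nhds hz)).differentiableAt (by norm_num)).lineDifferentiableAt
        (v := EuclideanSpace.single i (1 : ℝ))).hasLineDerivAt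
    have e2 : HasDerivAt (fun t : ℝ =>
        c * (2 * ((z + t • EuclideanSpace.single i (1 : ℝ)) i - x i))) (c * (2 * 1)) 0 := by
      have : HasDerivAt (fun t : ℝ => c * (2 * ((z i - x i) + t))) (c * (2 * 1)) 0 :=
        (((hasDerivAt_id (0 : ℝ)).const_add _).const_mul 2).const_mul c
      refine HasDerivAt.congr_of_eventuallyEq this (Eventually.of_forall fun t => ?_)
      have ht : (z + t • EuclideanSpace.single i (1 : ℝ)) i = z i + t := by simp
      beta_reduce
      rw [ht]
      ring
    have e3 : HasDerivAt (fun t : ℝ => partialDeriv i f (z + t • EuclideanSpace.single i (1 : ℝ)))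
      (partialDeriv i (partialDeriv i f) z) 0 := e1
    have e4 := e3.fun_neg.fun_sub e2
    exact e4.deriv.trans (by ring)
  simp only [partialLaplacian, h2]
  rw [Finset.sum_sub_distrib, Finset.sum_neg_distrib, Finset.sum_const, Finset.card_univ,
    nsmul_eq_mul]
  ring

/-- A subharmonic function of class `C²` has nonnegative Laplacian. -/
theorem IsSubharmonicOn.partialLaplacian_nonneg {f : EuclideanSpace ℝ ι → ℝ}
    {U : Set (EuclideanSpace ℝ ι)} (hsub : IsSubharmonicOn (fun z => (f z : EReal)) U)
    (hU : IsOpen U) (hf : ContDiffOn ℝ 2 f U) {x : EuclideanSpace ℝ ι} (hx : x ∈ U) :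
    0 ≤ partialLaplacian Finset.univ f x := by
  by_contra! hneg
  have hne : Nonempty ι := by
    by_contra h
    rw [not_nonempty_iff] at h
    simp [partialLaplacian] at hneg
  have hcont : ContinuousOn (partialLaplacian Finset.univ f) U := by
    refine continuousOn_finsetSum _ fun i _ => ?_
    exact ((hf.partialDeriv_of_isOpen (m := 1) hU (by norm_num) i).partialDeriv_of_isOpen
      (m := 0) hU (by norm_num) i).continuousOn
  set d := -partialLaplacian Finset.univ f x with hd
  have hd0 : 0 < d := by linarith
  -- With this `c` the quadratic `c‖ζ - x‖²` has Laplacian `d/2`, while `-f` has Laplacian above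
  -- `d/2` near `x`. Their difference thus obeys the mean value inequality, and the positive mean of
  -- the quadratic makes the one for `-f` strict, contradicting that for `f`.
  set c := d / (4 * Fintype.card ι) with hc
  have hcard : (0 : ℝ) < Fintype.card ι := by exact_mod_cast Fintype.card_pos
  have hc0 : 0 < c := by positivity
  have hcd : 2 * c * Fintype.card ι = d / 2 := by rw [hc]; field_simp; norm_num
  have hev : ∀ᶠ z in 𝓝 x, z ∈ U ∧ partialLaplacian Finset.univ f z < -(d / 2) :=
    (hU.eventually_mem hx).and ((hcont.continuousAt (hU.mem_nhds hx)).eventually_lt_const (by linarith))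
  obtain ⟨δ, hδ, hball⟩ := Metric.eventually_nhds_iff_ball.1 hev
  have hBU : Metric.ball x δ ⊆ U := fun z hz => (hball z hz).1
  have hr : 0 < δ / 2 := by positivity
  have hsubset : Metric.closedBall x (δ / 2) ⊆ Metric.ball x δ :=
    Metric.closedBall_subset_ball (by linarith)
  have hfB : ContDiffOn ℝ 2 f (Metric.ball x δ) := hf.mono hBU
  have hq : ContDiff ℝ 2 fun ζ : EuclideanSpace ℝ ι => c * ‖ζ - x‖ ^ 2 :=
    contDiff_const.mul ((contDiff_norm_sq ℝ).comp (contDiff_id.sub contDiff_const))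
  have hmean := mul_volume_closedBall_le_integral (f := fun ζ => -f ζ - c * ‖ζ - x‖ ^ 2)
    Metric.isOpen_ball (hfB.neg.sub hq.contDiffOn) (fun z hz => by
      rw [partialLaplacian_neg_sub_norm_sq Metric.isOpen_ball hfB c x hz, hcd]
      linarith [(hball z hz).2]) hr hsubset
  have hfi : IntegrableOn f (Metric.closedBall x (δ / 2)) :=
    (hf.continuousOn.mono (hsubset.trans hBU)).integrableOn_compact (isCompact_closedBall _ _)
  have hqi : IntegrableOn (fun ζ : EuclideanSpace ℝ ι => c * ‖ζ - x‖ ^ 2)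
      (Metric.closedBall x (δ / 2)) :=
    hq.continuous.continuousOn.integrableOn_compact (isCompact_closedBall _ _)
  rw [integral_sub (f := fun ζ => -f ζ) hfi.neg hqi, integral_neg] at hmean
  have hVpos : 0 < volume.real (Metric.closedBall x (δ / 2)) :=
    ENNReal.toReal_pos (Metric.measure_closedBall_pos volume x hr).ne' measure_closedBall_lt_top.ne
  have h1 := hsub.le_ballMean x (δ / 2) hr (hsubset.trans hBU)
  rw [ballMean_coe hfi, EReal.coe_le_coe_iff, le_div_iff₀ hVpos] at h1
  have h2 : 0 < ∫ ζ in Metric.closedBall x (δ / 2), c * ‖ζ - x‖ ^ 2 := by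
    rw [setIntegral_pos_iff_support_of_nonneg_ae (Eventually.of_forall fun ζ => by positivity) hqi]
    have hs : Metric.closedBall x (δ / 2) \ {x} ⊆
        (Function.support fun ζ : EuclideanSpace ℝ ι => c * ‖ζ - x‖ ^ 2) ∩
          Metric.closedBall x (δ / 2) := fun ζ hζ => by
      refine ⟨?_, hζ.1⟩
      have : ζ - x ≠ 0 := sub_ne_zero.2 hζ.2
      simp only [Function.mem_support]
      positivity
    refine lt_of_lt_of_le ?_ (measure_mono hs)
    rw [measure_sdiff_null (measure_singleton x)]
    exact Metric.measure_closedBall_pos volume x hr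
  simp only [sub_self, norm_zero] at hmean
  nlinarith

end BallMean

/-! ### Mollification preserves nonnegativity of partial Laplacians -/

section Mollification

variable {ι : Type*} [Fintype ι] {k : ℝ → ℝ}

open scoped Convolution in
theorem radialAverage_eq_convolution (k : ℝ → ℝ) (f : EuclideanSpace ℝ ι → ℝ) (ε : ℝ) :
    radialAverage k f ε = f ⋆[ContinuousLinearMap.lsmul ℝ ℝ] (radialKernel k ε) := by
  ext z
  rw [radialAverage, convolution_def]
  refine integral_congr_ae (Eventually.of_forall fun ζ => ?_)
  simp [radialKernel, norm_sub_rev ζ z]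

theorem IsRadialProfile.hasCompactSupport_radialKernel (hk : IsRadialProfile k) {ε : ℝ}
    (hε : 0 < ε) : HasCompactSupport (radialKernel k ε : EuclideanSpace ℝ ι → ℝ) := by
  simpa using hasCompactSupport_comp_sub (fun _ => hk.radialKernel_eq_zero (ι := ι) hε) 0

theorem IsRadialProfile.contDiff_radialAverage (hk : IsRadialProfile k)
    {f : EuclideanSpace ℝ ι → ℝ} (hf : LocallyIntegrable f) {ε : ℝ} (hε : 0 < ε) :
    ContDiff ℝ 2 (radialAverage k f ε) := by
  rw [radialAverage_eq_convolution]
  exact (hk.hasCompactSupport_radialKernel hε).contDiff_convolution_right (n := 2) _ hf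
    (hk.contDiff_radialKernel ε)

variable [DecidableEq ι]

open scoped Convolution in
theorem partialDeriv_convolution {f g : EuclideanSpace ℝ ι → ℝ} (hf : LocallyIntegrable f)
    (hg : ContDiff ℝ 1 g) (hc : HasCompactSupport g) (i : ι) :
    partialDeriv i (f ⋆[ContinuousLinearMap.lsmul ℝ ℝ] g) =
      f ⋆[ContinuousLinearMap.lsmul ℝ ℝ] (partialDeriv i g) := by
  ext z
  have h := hc.hasFDerivAt_convolution_right (ContinuousLinearMap.lsmul ℝ ℝ) hf hg z
  have h1 : partialDeriv i g = fun a => fderiv ℝ g a (EuclideanSpace.single i 1) :=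
    funext fun a => ((hg.differentiable (by norm_num)) a).lineDeriv_eq_fderiv
  rw [h1, ← convolution_precompR_apply (ContinuousLinearMap.lsmul ℝ ℝ) hf (hc.fderiv ℝ)
    (hg.continuous_fderiv (by norm_num))]
  exact (h.hasLineDerivAt _).lineDeriv

theorem partialDeriv_comp_const_sub (g : EuclideanSpace ℝ ι → ℝ) (z : EuclideanSpace ℝ ι) (i : ι) :
    partialDeriv i (fun ζ => g (z - ζ)) = fun ζ => -partialDeriv i g (z - ζ) := by
  ext ζ
  simp only [partialDeriv, lineDeriv]
  have h := deriv_comp_neg (fun t : ℝ => g (z - ζ + t • EuclideanSpace.single i (1 : ℝ))) 0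
  rw [neg_zero] at h
  rw [← h]
  congr 1
  ext t
  congr 1
  rw [neg_smul]
  abel

theorem partialLaplacian_comp_const_sub (s : Finset ι) (g : EuclideanSpace ℝ ι → ℝ)
    (z ζ : EuclideanSpace ℝ ι) :
    partialLaplacian s (fun ζ => g (z - ζ)) ζ = partialLaplacian s g (z - ζ) := by
  refine Finset.sum_congr rfl fun i _ => ?_
  rw [partialDeriv_comp_const_sub]
  have h1 : (fun ζ => -partialDeriv i g (z - ζ)) = fun ζ => (-partialDeriv i g) (z - ζ) := rfl
  rw [h1, partialDeriv_comp_const_sub]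
  simp only [partialDeriv, lineDeriv, Pi.neg_apply]
  rw [deriv.fun_neg, neg_neg]

open scoped Convolution in
/-- The weighted averages of a weakly subharmonic function have nonnegative partial Laplacian. -/
theorem IsWeaklySubharmonicOn.partialLaplacian_radialAverage_nonneg {s : Finset ι}
    {f : EuclideanSpace ℝ ι → ℝ} {Ω : Set (EuclideanSpace ℝ ι)}
    (h : IsWeaklySubharmonicOn s f Ω) (hf : LocallyIntegrable f) (hk : IsRadialProfile k) {ε : ℝ}
    (hε : 0 < ε) {z : EuclideanSpace ℝ ι} (hz : Metric.closedBall z ε ⊆ Ω) :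
    0 ≤ partialLaplacian s (radialAverage k f ε) z := by
  have hρ : ContDiff ℝ 2 (radialKernel k ε : EuclideanSpace ℝ ι → ℝ) := hk.contDiff_radialKernel ε
  have hc : HasCompactSupport (radialKernel k ε : EuclideanSpace ℝ ι → ℝ) :=
    hk.hasCompactSupport_radialKernel hε
  have hρ₁ : ∀ i, ContDiff ℝ 1 (partialDeriv i (radialKernel k ε : EuclideanSpace ℝ ι → ℝ)) :=
    fun i => hρ.partialDeriv (by norm_num) i
  have hc₁ : ∀ i, HasCompactSupport (partialDeriv i (radialKernel k ε : EuclideanSpace ℝ ι → ℝ)) :=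
    fun i => hc.of_isClosed_subset (isClosed_tsupport _) (tsupport_partialDeriv_subset i _)
  -- The kernel is even, so the translate used as test function is also the convolution kernel; two
  -- derivatives in `ζ` restore the sign.
  have hflip : (fun ζ => radialKernel k ε (ζ - z)) = fun ζ => radialKernel k ε (z - ζ) := by
    ext ζ
    simp [radialKernel, norm_sub_rev ζ z]
  have hsupp := tsupport_comp_sub_subset (fun _ => hk.radialKernel_eq_zero hε) z
  have hcomp := hasCompactSupport_comp_sub (fun _ => hk.radialKernel_eq_zero hε) z
  rw [hflip] at hsupp hcomp
  have hφ : ContDiff ℝ 2 fun ζ => radialKernel k ε (z - ζ) := hρ.comp (contDiff_const.sub contDiff_id)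
  have key := h _ hφ hcomp (hsupp.trans hz) fun ζ => hk.radialKernel_nonneg hε _
  rw [integral_mul_partialLaplacian (hf.locallyIntegrableOn univ) hφ hcomp (subset_univ _)] at key
  refine key.trans_eq (Finset.sum_congr rfl fun i _ => ?_)
  rw [radialAverage_eq_convolution, partialDeriv_convolution hf (hρ.of_le (by norm_num)) hc,
    partialDeriv_convolution hf (hρ₁ i) (hc₁ i), convolution_def]
  refine integral_congr_ae (Eventually.of_forall fun ζ => ?_)
  have := partialLaplacian_comp_const_sub {i} (radialKernel k ε) z ζ
  simp only [partialLaplacian, Finset.sum_singleton] at this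
  simp [this]

/-- Derivatives of a test function supported in `A` vanish off `A`. Truncation provides the global
local integrability needed for convolutions. -/
theorem IsWeaklySubharmonicOn.indicator {s : Finset ι} {f : EuclideanSpace ℝ ι → ℝ}
    {Ω A : Set (EuclideanSpace ℝ ι)} (h : IsWeaklySubharmonicOn s f Ω) (hA : A ⊆ Ω) :
    IsWeaklySubharmonicOn s (A.indicator f) A := by
  intro φ hφ hc hs h0
  refine (h φ hφ hc (hs.trans hA) h0).trans_eq (integral_congr_ae (Eventually.of_forall fun z => ?_))
  by_cases hz : z ∈ A
  · simp [hz]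
  · have hz0 : partialLaplacian s φ z = 0 := by
      refine Finset.sum_eq_zero fun i _ => image_eq_zero_of_notMem_tsupport fun hmem => hz ?_
      exact hs (tsupport_partialDeriv_subset i _ (tsupport_partialDeriv_subset i _ hmem))
    simp [hz0]

/-- A slice of a function along an affine coordinate subspace has as Laplacian the partial
Laplacian along that subspace. -/
theorem partialLaplacian_comp_slice {α : Type*} [Fintype α] [DecidableEq α] (σ : α ↪ ι)
    {P : EuclideanSpace ℝ α → EuclideanSpace ℝ ι}
    (hP : ∀ x j (t : ℝ), P (x + t • EuclideanSpace.single j 1) =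
      P x + t • EuclideanSpace.single (σ j) 1)
    (f : EuclideanSpace ℝ ι → ℝ) (x : EuclideanSpace ℝ α) :
    partialLaplacian Finset.univ (fun x => f (P x)) x =
      partialLaplacian (Finset.univ.map σ) f (P x) := by
  have h : ∀ (g : EuclideanSpace ℝ ι → ℝ) (j : α),
      partialDeriv j (fun x => g (P x)) = fun x => partialDeriv (σ j) g (P x) := fun g j => by
    ext x
    simp only [partialDeriv, lineDeriv, hP]
  simp only [partialLaplacian, Finset.sum_map, h]

end Mollification

/-! ### The regularization and its subharmonicity on slices -/

section Regularization

variable {ι : Type*} [Fintype ι] {k : ℝ → ℝ} {w : EuclideanSpace ℝ ι → ℝ}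
  {Ω : Set (EuclideanSpace ℝ ι)}

theorem exists_isRadialProfile_integral_eq_one (ι : Type*) [Fintype ι] :
    ∃ k, IsRadialProfile k ∧ ∫ v : EuclideanSpace ℝ ι, k (‖v‖ ^ 2) = 1 := by
  have hk := isRadialProfile_smoothTransition (m := 1) zero_le_one
  set k : ℝ → ℝ := fun t => Real.smoothTransition (1 * (1 - t)) with hkdef
  have hcont : Continuous fun v : EuclideanSpace ℝ ι => k (‖v‖ ^ 2) :=
    hk.contDiff.continuous.comp (by fun_prop)
  have hcomp : HasCompactSupport fun v : EuclideanSpace ℝ ι => k (‖v‖ ^ 2) := by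
    have h1 : (radialKernel k 1 : EuclideanSpace ℝ ι → ℝ) = fun v => k (‖v‖ ^ 2) := by
      ext v
      simp [radialKernel]
    exact h1 ▸ hk.hasCompactSupport_radialKernel (ι := ι) one_pos
  have hpos : 0 < ∫ v : EuclideanSpace ℝ ι, k (‖v‖ ^ 2) :=
    hcont.integral_pos_of_hasCompactSupport_nonneg_nonzero hcomp (fun v => hk.nonneg _)
      (x := 0) (by simp [hkdef])
  refine ⟨_, hk.const_mul (inv_nonneg.2 hpos.le), ?_⟩
  rw [integral_const_mul, inv_mul_cancel₀ hpos.ne']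

/-- The infimum of the weighted averages of `w` over all scales admissible in `Ω`. -/
noncomputable def subharmonicRegularization (k : ℝ → ℝ) (w : EuclideanSpace ℝ ι → ℝ)
    (Ω : Set (EuclideanSpace ℝ ι)) (z : EuclideanSpace ℝ ι) : EReal :=
  ⨅ (ε : ℝ) (_ : 0 < ε ∧ Metric.closedBall z ε ⊆ Ω), (radialAverage k w ε z : EReal)

theorem subharmonicRegularization_le {z : EuclideanSpace ℝ ι} {ε : ℝ} (hε : 0 < ε)
    (hz : Metric.closedBall z ε ⊆ Ω) :
    subharmonicRegularization k w Ω z ≤ (radialAverage k w ε z : EReal) :=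
  iInf₂_le ε ⟨hε, hz⟩

theorem subharmonicRegularization_lt_top (hΩ : IsOpen Ω) {z : EuclideanSpace ℝ ι} (hz : z ∈ Ω) :
    subharmonicRegularization k w Ω z < ⊤ := by
  obtain ⟨ε, hε, h⟩ := Metric.nhds_basis_closedBall.mem_iff.1 (hΩ.mem_nhds hz)
  exact (subharmonicRegularization_le hε h).trans_lt (EReal.coe_lt_top _)

theorem locallyIntegrable_indicator (hw : LocallyIntegrableOn w Ω) {A : Set (EuclideanSpace ℝ ι)}
    (hA : IsCompact A) (hAΩ : A ⊆ Ω) : LocallyIntegrable (A.indicator w) :=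
  ((hw.integrableOn_compact_subset hAΩ hA).integrable_indicator
    hA.isClosed.measurableSet).locallyIntegrable

theorem closedBall_subset_cthickening_of_mem_thickening {S : Set (EuclideanSpace ℝ ι)} {δ ε : ℝ}
    {z : EuclideanSpace ℝ ι} (hz : z ∈ Metric.thickening (δ / 2) S) (hε : ε ≤ δ / 2) :
    Metric.closedBall z ε ⊆ Metric.cthickening δ S := by
  intro y hy
  obtain ⟨x, hx, hzx⟩ := Metric.mem_thickening_iff.1 hz
  refine Metric.mem_cthickening_of_dist_le y x δ S hx ?_
  rw [Metric.mem_closedBall] at hy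
  linarith [dist_triangle y z x]

/-- A scale admissible at `z` remains admissible nearby, because the compact ball has room inside
`Ω`, and the average at a fixed scale is continuous there. An infimum of such averages is upper
semicontinuous. -/
theorem upperSemicontinuousOn_subharmonicRegularization (hΩ : IsOpen Ω) (hk : IsRadialProfile k)
    (hw : LocallyIntegrableOn w Ω) : UpperSemicontinuousOn (subharmonicRegularization k w Ω) Ω := by
  intro z _ c hc
  simp only [subharmonicRegularization, iInf_lt_iff] at hc
  obtain ⟨ε, ⟨hε, hz⟩, hlt⟩ := hc
  obtain ⟨δ, hδ, hsub⟩ := (isCompact_closedBall z ε).exists_cthickening_subset_open hΩ hz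
  set A := Metric.cthickening δ (Metric.closedBall z ε) with hA
  have hAc : IsCompact A := (isCompact_closedBall z ε).cthickening
  have hcont := (hk.contDiff_radialAverage (locallyIntegrable_indicator hw hAc hsub) hε).continuous
  have hball : ∀ z' ∈ Metric.ball z δ, Metric.closedBall z' ε ⊆ A := fun z' hz' y hy => by
    rw [hA, cthickening_closedBall hδ.le hε.le, Metric.mem_closedBall]
    rw [Metric.mem_ball] at hz'
    rw [Metric.mem_closedBall] at hy
    linarith [dist_triangle y z' z]
  have hev : ∀ᶠ z' in 𝓝 z, (radialAverage k (A.indicator w) ε z' : EReal) < c := by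
    refine (continuous_coe_real_ereal.comp hcont).continuousAt.eventually_lt_const ?_
    simp only [Function.comp_apply]
    rwa [radialAverage_indicator hk w hε (hball z (Metric.mem_ball_self hδ))]
  refine Filter.Eventually.filter_mono nhdsWithin_le_nhds ?_
  filter_upwards [hev, Metric.ball_mem_nhds z hδ] with z' h1 h2
  rw [radialAverage_indicator hk w hε (hball z' h2)] at h1
  exact (subharmonicRegularization_le hε ((hball z' h2).trans hsub)).trans_lt h1

variable [DecidableEq ι]

/-- By monotonicity in the scale the infimum is the limit at scale zero, which is `w z` for a kernel
of unit mass. -/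
theorem subharmonicRegularization_eq (hΩ : IsOpen Ω) (hk : IsRadialProfile k)
    (hk1 : ∫ v : EuclideanSpace ℝ ι, k (‖v‖ ^ 2) = 1) (hw : LocallyIntegrableOn w Ω)
    (hsub : IsWeaklySubharmonicOn Finset.univ w Ω) {z : EuclideanSpace ℝ ι} (hz : z ∈ Ω)
    (hwz : ContinuousAt w z) : subharmonicRegularization k w Ω z = (w z : EReal) := by
  have hlim := hk.tendsto_radialAverage hΩ hw hz hwz
  rw [hk1, mul_one] at hlim
  refine le_antisymm ?_ (le_iInf₂ fun R hR => ?_)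
  · obtain ⟨R, hR, h⟩ := Metric.nhds_basis_closedBall.mem_iff.1 (hΩ.mem_nhds hz)
    refine ge_of_tendsto ((continuous_coe_real_ereal.tendsto _).comp hlim) ?_
    filter_upwards [Ioc_mem_nhdsGT hR] with ε hε
    exact subharmonicRegularization_le hε.1 ((Metric.closedBall_subset_closedBall hε.2).trans h)
  · refine EReal.coe_le_coe_iff.2 (le_of_tendsto hlim ?_)
    filter_upwards [Ioc_mem_nhdsGT hR.1] with ε hε
    exact hsub.monotoneOn_radialAverage hw hk hR.2 hε ⟨hR.1, le_rfl⟩ hε.2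

/-- The regularization of a weakly subharmonic function is subharmonic on every affine coordinate
subspace along which the function is weakly subharmonic. -/
theorem isSubharmonicOn_subharmonicRegularization_comp {α : Type*} [Fintype α] [DecidableEq α]
    (hΩ : IsOpen Ω) (hk : IsRadialProfile k) (hw : LocallyIntegrableOn w Ω)
    (hsub : IsWeaklySubharmonicOn Finset.univ w Ω) (σ : α ↪ ι)
    (hσ : IsWeaklySubharmonicOn (Finset.univ.map σ) w Ω)
    {P : EuclideanSpace ℝ α → EuclideanSpace ℝ ι} (hPd : ContDiff ℝ 2 P)
    (hP : ∀ x j (t : ℝ), P (x + t • EuclideanSpace.single j 1) =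
      P x + t • EuclideanSpace.single (σ j) 1) :
    IsSubharmonicOn (fun x => subharmonicRegularization k w Ω (P x)) {x | P x ∈ Ω} := by
  refine ⟨fun x hx => subharmonicRegularization_lt_top hΩ hx, ?_, fun x r hr hball => ?_⟩
  · intro x hx c hc
    have h1 := upperSemicontinuousOn_subharmonicRegularization hΩ hk hw (P x) hx c hc
    exact (hPd.continuous.continuousWithinAt.tendsto_nhdsWithin fun y hy => hy).eventually h1
  set S := P '' Metric.closedBall x r with hS
  have hSc : IsCompact S := (isCompact_closedBall x r).image hPd.continuous
  obtain ⟨δ, hδ, hδΩ⟩ := hSc.exists_cthickening_subset_open hΩ (by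
    rintro _ ⟨y, hy, rfl⟩
    exact hball hy)
  set A := Metric.cthickening δ S with hA
  have hAc : IsCompact A := hSc.cthickening
  have hloc := locallyIntegrable_indicator hw hAc hδΩ
  -- Half of the room `δ` is spent on the scale. The other half thickens `S`, so that the averages
  -- have nonnegative Laplacian on an open set containing the ball, as the mean value inequality
  -- requires.
  set e : ℕ → ℝ := fun m => δ / 2 / (m + 1) with he
  have he0 : ∀ m, 0 < e m := fun m => by positivity
  have heanti : Antitone e := fun m n hmn => by
    simp only [he]
    gcongr
  have he1 : ∀ m, e m ≤ δ / 2 := fun m => by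
    simpa [he] using heanti (Nat.zero_le m)
  have helim : Tendsto e atTop (𝓝 0) := by
    simpa [he, div_eq_mul_inv] using
      tendsto_one_div_add_atTop_nhds_zero_nat.const_mul (δ / 2)
  have hThick : ∀ y ∈ Metric.closedBall x r, P y ∈ Metric.thickening (δ / 2) S := fun y hy =>
    Metric.self_subset_thickening (by positivity) S (mem_image_of_mem P hy)
  have hsubA : ∀ y ∈ Metric.closedBall x r, ∀ ε ≤ δ / 2, Metric.closedBall (P y) ε ⊆ A :=
    fun y hy ε hε => closedBall_subset_cthickening_of_mem_thickening (hThick y hy) hε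
  have hsmooth : ∀ m, ContDiff ℝ 2 fun y => radialAverage k (A.indicator w) (e m) (P y) := fun m =>
    (hk.contDiff_radialAverage hloc (he0 m)).comp hPd
  have hmonoR : ∀ y ∈ Metric.closedBall x r,
      MonotoneOn (fun ε => radialAverage k w ε (P y)) (Ioc 0 (δ / 2)) := fun y hy =>
    hsub.monotoneOn_radialAverage hw hk ((hsubA y hy _ le_rfl).trans hδΩ)
  refine le_ballMean_of_antitone (g := fun m y => radialAverage k (A.indicator w) (e m) (P y)) hr
    (fun m => (hsmooth m).continuous) (fun y hy m n hmn => ?_) (fun y hy => ?_) fun m => ?_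
  · simp only
    rw [radialAverage_indicator hk w (he0 _) (hsubA y hy _ (he1 _)),
      radialAverage_indicator hk w (he0 _) (hsubA y hy _ (he1 _))]
    exact hmonoR y hy ⟨he0 n, he1 n⟩ ⟨he0 m, he1 m⟩ (heanti hmn)
  · refine le_antisymm (le_iInf fun m => ?_) (le_iInf₂ fun ε hε => ?_)
    · rw [radialAverage_indicator hk w (he0 _) (hsubA y hy _ (he1 _))]
      exact subharmonicRegularization_le (he0 m) ((hsubA y hy _ (he1 m)).trans hδΩ)
    · obtain ⟨m, hm⟩ := (helim.eventually_le_const hε.1).exists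
      refine (iInf_le _ m).trans ?_
      rw [radialAverage_indicator hk w (he0 _) (hsubA y hy _ (he1 _)), EReal.coe_le_coe_iff]
      exact hsub.monotoneOn_radialAverage hw hk hε.2 ⟨he0 m, hm⟩ ⟨hε.1, le_rfl⟩ hm
  · have hxmem : x ∈ Metric.closedBall x r := Metric.mem_closedBall_self hr.le
    refine (subharmonicRegularization_le (he0 m) ((hsubA x hxmem _ (he1 m)).trans hδΩ)).trans ?_
    have hmean := mul_volume_closedBall_le_integral
      (Metric.isOpen_thickening.preimage hPd.continuous) (hsmooth m).contDiffOn (fun y hy => by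
        rw [partialLaplacian_comp_slice σ hP]
        exact (hσ.indicator hδΩ).partialLaplacian_radialAverage_nonneg hloc hk (he0 m)
          (closedBall_subset_cthickening_of_mem_thickening hy (he1 m))) hr hThick
    have hVpos : 0 < volume.real (Metric.closedBall x r) :=
      ENNReal.toReal_pos (Metric.measure_closedBall_pos volume x hr).ne'
        measure_closedBall_lt_top.ne
    rw [ballMean_coe ((hsmooth m).continuous.continuousOn.integrableOn_compact
      (isCompact_closedBall x r)), EReal.coe_le_coe_iff, le_div_iff₀ hVpos,
      ← radialAverage_indicator hk w (he0 m) (hsubA x hxmem _ (he1 m))]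
    exact hmean

end Regularization

/-! ### The two groups of variables, and the conclusion -/

section Pairs

variable {p q : ℕ}

theorem pairPt_add_left (x : EuclideanSpace ℝ (Fin p)) (y : EuclideanSpace ℝ (Fin q)) (j : Fin p)
    (t : ℝ) : pairPt (x + t • EuclideanSpace.single j 1) y =
      pairPt x y + t • EuclideanSpace.single (Function.Embedding.inl j) 1 := by
  ext (i | i) <;> simp [pairPt]

theorem pairPt_add_right (x : EuclideanSpace ℝ (Fin p)) (y : EuclideanSpace ℝ (Fin q)) (j : Fin q)
    (t : ℝ) : pairPt x (y + t • EuclideanSpace.single j 1) =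
      pairPt x y + t • EuclideanSpace.single (Function.Embedding.inr j) 1 := by
  ext (i | i) <;> simp [pairPt]

theorem contDiff_pairPt_left (y : EuclideanSpace ℝ (Fin q)) :
    ContDiff ℝ 2 fun x : EuclideanSpace ℝ (Fin p) => pairPt x y := by
  rw [contDiff_euclidean]
  rintro (i | i)
  · exact contDiff_euclidean.1 contDiff_id i
  · exact contDiff_const

theorem contDiff_pairPt_right (x : EuclideanSpace ℝ (Fin p)) :
    ContDiff ℝ 2 fun y : EuclideanSpace ℝ (Fin q) => pairPt x y := by
  rw [contDiff_euclidean]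
  rintro (i | i)
  · exact contDiff_const
  · exact contDiff_euclidean.1 contDiff_id i

theorem exists_pairPt_eq (z : EuclideanSpace ℝ (Fin p ⊕ Fin q)) : ∃ x y, pairPt x y = z :=
  ⟨WithLp.toLp 2 fun j => z (Sum.inl j), WithLp.toLp 2 fun k => z (Sum.inr k), by
    ext (i | i) <;> rfl⟩

theorem card_ne_sum (i : Fin p ⊕ Fin q) :
    (p : ℝ) + q - 1 = Fintype.card {k : Fin p ⊕ Fin q // k ≠ i} := by
  have h : Fintype.card {k : Fin p ⊕ Fin q // k ≠ i} + 1 = p + q := by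
    have h1 := Fintype.card_subtype_compl (fun k => k = i)
    have h2 : 0 < Fintype.card (Fin p ⊕ Fin q) := Fintype.card_pos_iff.2 ⟨i⟩
    simp only [Fintype.card_subtype_eq, Fintype.card_sum, Fintype.card_fin] at h1 h2
    simp only [ne_eq]
    omega
  have h' : ((Fintype.card {k : Fin p ⊕ Fin q // k ≠ i} : ℕ) : ℝ) + 1 = p + q := by
    exact_mod_cast h
  linarith

end Pairs

theorem isOpen_sdiff_of_isClosed_preimage {X : Type*} [TopologicalSpace X] {Ω E : Set X}
    (hΩ : IsOpen Ω) (hE : IsClosed ((Subtype.val : Ω → X) ⁻¹' E)) : IsOpen (Ω \ E) := by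
  have h := hΩ.isOpenMap_subtype_val _ hE.isOpen_compl
  convert h using 1
  ext z
  simp

/-- A function that is continuous off `E` and weakly subharmonic in both groups of variables has a
separately subharmonic extension. -/
theorem exists_separatelySubharmonicExtension {p q : ℕ} {Ω E : Set (EuclideanSpace ℝ (Fin p ⊕ Fin q))}
    {w : EuclideanSpace ℝ (Fin p ⊕ Fin q) → ℝ} (hΩ : IsOpen Ω) (hU : IsOpen (Ω \ E))
    (hw : LocallyIntegrableOn w Ω) (hc : ContinuousOn w (Ω \ E))
    (hl : IsWeaklySubharmonicOn (Finset.univ.map Function.Embedding.inl) w Ω)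
    (hr : IsWeaklySubharmonicOn (Finset.univ.map Function.Embedding.inr) w Ω) :
    ∃ W : EuclideanSpace ℝ (Fin p ⊕ Fin q) → EReal,
      IsSeparatelySubharmonicOn W Ω ∧ ∀ z ∈ Ω \ E, W z = (w z : EReal) := by
  obtain ⟨k, hk, hk1⟩ := exists_isRadialProfile_integral_eq_one (Fin p ⊕ Fin q)
  -- The full Laplacian is the sum of the two partial ones. A single full-dimensional regularization
  -- then serves both families of slices.
  have hsub : IsWeaklySubharmonicOn Finset.univ w Ω := by
    have hd : Disjoint ((Finset.univ : Finset (Fin p)).map (Function.Embedding.inl (β := Fin q)))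
        ((Finset.univ : Finset (Fin q)).map (Function.Embedding.inr (α := Fin p))) := by
      simp [Finset.disjoint_left]
    convert IsWeaklySubharmonicOn.union hw hl hr hd
    ext (i | i) <;> simp
  refine ⟨subharmonicRegularization k w Ω, ⟨fun y => ?_, fun x => ?_⟩, fun z hz => ?_⟩
  · exact isSubharmonicOn_subharmonicRegularization_comp hΩ hk hw hsub _ hl
      (contDiff_pairPt_left y) fun x j t => pairPt_add_left x y j t
  · exact isSubharmonicOn_subharmonicRegularization_comp hΩ hk hw hsub _ hr
      (contDiff_pairPt_right x) fun y j t => pairPt_add_right x y j t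
  · exact subharmonicRegularization_eq hΩ hk hk1 hw hsub hz.1 (hc.continuousAt (hU.mem_nhds hz))

theorem theorem2 (p q : ℕ) (hp : 2 ≤ p) (hq : 2 ≤ q)
    (Ω E : Set (EuclideanSpace ℝ (Fin p ⊕ Fin q)))
    (hΩo : IsOpen Ω) (hΩc : IsConnected Ω)
    (hEΩ : E ⊆ Ω) (hEc : IsClosed ((Subtype.val : Ω → EuclideanSpace ℝ (Fin p ⊕ Fin q)) ⁻¹' E))
    (hEH : Measure.hausdorffMeasure ((p : ℝ) + q - 1) E < ⊤)
    (w : EuclideanSpace ℝ (Fin p ⊕ Fin q) → ℝ)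
    (hw : IsSeparatelySubharmonicOn (fun z => (w z : EReal)) (Ω \ E))
    (h_i : LocallyIntegrableOn w Ω volume)
    (h_ii : ContDiffOn ℝ 2 w (Ω \ E))
    (h_iii_x : ∀ j : Fin p,
      LocallyIntegrableOn (partialDeriv (Sum.inl j) (partialDeriv (Sum.inl j) w)) Ω volume)
    (h_iii_y : ∀ k : Fin q,
      LocallyIntegrableOn (partialDeriv (Sum.inr k) (partialDeriv (Sum.inr k) w)) Ω volume)
    (h_iv : ∀ j : Fin p,
      ∀ᵐ X ∂(Measure.hausdorffMeasure ((p : ℝ) + q - 1) :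
        Measure (EuclideanSpace ℝ {i : Fin p ⊕ Fin q // i ≠ Sum.inl j})),
        (lineSection (Sum.inl j) E X).Finite → LineCondition (Sum.inl j) Ω E w X)
    (h_v : ∀ k : Fin q,
      ∀ᵐ Y ∂(Measure.hausdorffMeasure ((p : ℝ) + q - 1) :
        Measure (EuclideanSpace ℝ {i : Fin p ⊕ Fin q // i ≠ Sum.inr k})),
        (lineSection (Sum.inr k) E Y).Finite → LineCondition (Sum.inr k) Ω E w Y) :
    ∃ W : EuclideanSpace ℝ (Fin p ⊕ Fin q) → EReal,
      IsSeparatelySubharmonicOn W Ω ∧ ∀ z ∈ Ω \ E, W z = (w z : EReal) := by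
  have hU : IsOpen (Ω \ E) := isOpen_sdiff_of_isClosed_preimage hΩo hEc
  have hE0 : volume E = 0 := volume_eq_zero_of_hausdorffMeasure_lt_top (by simp) hEH
  have hfin : ∀ i : Fin p ⊕ Fin q, ∀ᵐ X : EuclideanSpace ℝ {k : Fin p ⊕ Fin q // k ≠ i},
      (lineSection i E X).Finite := fun i => ae_finite_lineSection i (card_ne_sum i) hEH
  have hline : ∀ i : Fin p ⊕ Fin q, ∀ᵐ X : EuclideanSpace ℝ {k : Fin p ⊕ Fin q // k ≠ i},
      LineCondition i Ω E w X := by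
    intro i
    -- The assumed condition is conditional on a finite section; `hfin` removes that clause for
    -- almost every line.
    have h : ∀ᵐ X : EuclideanSpace ℝ {k : Fin p ⊕ Fin q // k ≠ i},
        (lineSection i E X).Finite → LineCondition i Ω E w X := by
      have hac := volume_absolutelyContinuous_hausdorffMeasure (card_ne_sum i)
      rcases i with j | k
      · exact hac.ae_le (h_iv j)
      · exact hac.ae_le (h_v k)
    filter_upwards [h, hfin i] with X h1 h2 using h1 h2
  refine exists_separatelySubharmonicExtension hΩo hU h_i h_ii.continuousOn ?_ ?_
  · refine isWeaklySubharmonicOn_of_lineCondition hU hΩo hE0 h_ii h_i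
      (by simpa using h_iii_x) (fun i _ => hfin i) (fun i _ => hline i) fun z hz => ?_
    obtain ⟨x, y, rfl⟩ := exists_pairPt_eq z
    rw [← partialLaplacian_comp_slice (P := fun x => pairPt x y) Function.Embedding.inl
      fun x j t => pairPt_add_left x y j t]
    exact (hw.left y).partialLaplacian_nonneg
      (hU.preimage (contDiff_pairPt_left y).continuous)
      (h_ii.comp (contDiff_pairPt_left y).contDiffOn fun _ h => h) hz
  · refine isWeaklySubharmonicOn_of_lineCondition hU hΩo hE0 h_ii h_i
      (by simpa using h_iii_y) (fun i _ => hfin i) (fun i _ => hline i) fun z hz => ?_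
    obtain ⟨x, y, rfl⟩ := exists_pairPt_eq z
    rw [← partialLaplacian_comp_slice (P := fun y => pairPt x y) Function.Embedding.inr
      fun y j t => pairPt_add_right x y j t]
    exact (hw.right x).partialLaplacian_nonneg
      (hU.preimage (contDiff_pairPt_right x).continuous)
      (h_ii.comp (contDiff_pairPt_right x).contDiffOn fun _ h => h) hz
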